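/- Let $(E,\|\cdot\|)$ be a finite-dimensional real normed space. A norm $\pi$ on $E$ is called $\kappa$-smooth ($\kappa\ge1$) if $p=\pi^2$ is continuously differentiable and $p(x+y)\le p(x)+Dp(x)[y]+\kappa p(y)$ for all $x,y\in E$. The space $(E,\|\cdot\|)$ is called $\kappa$-regular if there are $\kappa_+\in[1,\kappa]$ and a $\kappa_+$-smooth norm $\|\cdot\|_+$ on $E$ such that $\|x\|^2\le\|x\|_+^2\le\frac{\kappa}{\kappa_+}\|x\|^2$ for all $x\in E$. Let $\Omega$ be a Polish space with a Borel probability measure, let $\mathcal F_0=\{\emptyset,\Omega\}\subset\mathcal F_1\subset\mathcal F_2\subset\dots$ be $\sigma$-subalgebras of its Borel $\sigma$-algebra, and let $\mathbf E_i$ be the conditional expectation with respect to $\mathcal F_i$. Let $\xi_1,\xi_2,\dots$ be an $E$-valued martingale-difference sequence: $\xi_i$ is $\mathcal F_i$-measurable and integrable, and $\mathbf E_{i-1}\{\xi_i\}=0$ a.s. Let $\sigma_1,\sigma_2,\dots>0$ be deterministic reals, and put $S_N=\sum_{i=1}^N\xi_i$, $\sigma^N=[\sigma_1;\dots;\sigma_N]$.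 For $\alpha\in[1,2]$ let $(\mathcal C_\alpha)$ be the condition $$\mathbf E_{i-1}\left\{\exp\{\|\xi_i\|^\alpha\sigma_i^{-\alpha}\}\right\}\le\exp\{1\}\quad\text{a.s. for all } i\ge1 .$$ Assume that $(E,\|\cdot\|)$ is $\kappa$-regular. Then the following holds. (i) If $1\le\alpha\le2$ and $(\mathcal C_\alpha)$ holds, then for all $N\ge1$ and $\gamma\ge0$ $$\mathrm{Prob}\left\{\|S_N\|\ge\left[\sqrt{2e\kappa}+\sqrt2\,\gamma\right]\sqrt{\textstyle\sum_{i=1}^N\sigma_i^2}\right\}\le2\exp\left\{-\tfrac1{64}\min\left[\gamma^2,\gamma_*^{2-\alpha}\gamma^\alpha\right]\right\},$$ where $\gamma_*=\gamma_*(\alpha,\sigma^N)$ is given as follows. For $1<\alpha<2$, with $\alpha_*=\frac{\alpha}{\alpha-1}$, $$\gamma_*=32\left[\frac{8\alpha_*}{2^{\alpha_*}}\right]^{\frac{\alpha-1}{2-\alpha}}\left[\frac{\|\sigma^N\|_2}{\|\sigma^N\|_{\alpha_*}}\right]^{\frac{\alpha}{2-\alpha}}\ \ge\ 16\left[\frac{\|\sigma^N\|_2}{\|\sigma^N\|_{\alpha_*}}\right]^{\frac{\alpha}{2-\alpha}}\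 \ge\ 16;$$ for $\alpha=1$, $\gamma_*=\lim_{\alpha\to1+0}\gamma_*(\alpha,\sigma^N)=16\,\|\sigma^N\|_2/\|\sigma^N\|_\infty$; for $\alpha=2$, $\gamma_*=\lim_{\alpha\to2-0}\gamma_*(\alpha,\sigma^N)=+\infty$ (and the minimum in the bound is then $\gamma^2$). The two inequalities and the two limits displayed here, for every $N\ge1$, are part of the claim. (ii) If $(\mathcal C_2)$ holds, then for all $N\ge1$ and $\gamma\ge0$ $$\mathrm{Prob}\left\{\|S_N\|\ge\left[\sqrt{2\kappa}+\sqrt2\,\gamma\right]\sqrt{\textstyle\sum_{i=1}^N\sigma_i^2}\right\}\le\exp\{-\gamma^2/3\}.$$ (iii) If $\|\xi_i\|\le\sigma_i$ a.s. for all $i\ge1$, then for all $N\ge1$ and $\gamma\ge0$ $$\mathrm{Prob}\left\{\|S_N\|\ge\left[\sqrt{2\kappa}+\sqrt2\,\gamma\right]\sqrt{\textstyle\sum_{i=1}^N\sigma_i^2}\right\}\le\exp\{-\gamma^2/2\}.$$ -/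

import Mathlib

open MeasureTheory Filter Topology
open scoped ENNReal

noncomputable section

namespace RegularSpace

/-- `q` is a norm on the real vector space `E` (a seminorm vanishing only at `0`). -/
def IsNorm {E : Type*} [AddCommGroup E] [Module ℝ E] (q : Seminorm ℝ E) : Prop :=
  ∀ x, q x = 0 → x = 0

/-- The norm `q` on the finite-dimensional space `E` is `κ`-smooth: `p = q ^ 2` is continuously
differentiable and `p (x + y) ≤ p x + Dp(x)[y] + κ * p y` for all `x, y`.  (Differentiability is
understood with respect to the topology of `E`, which in finite dimension is the one of `q`.) -/
def IsSmoothNorm {E : Type*} [NormedAddCommGroup E] [NormedSpace ℝ E]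
    (κ : ℝ) (q : Seminorm ℝ E) : Prop :=
  IsNorm q ∧ 1 ≤ κ ∧ ContDiff ℝ 1 (fun z : E => q z ^ 2) ∧
    ∀ x y : E, q (x + y) ^ 2 ≤ q x ^ 2 + fderiv ℝ (fun z : E => q z ^ 2) x y + κ * q y ^ 2

/-- The normed space `E` is `κ`-regular: for some `κ' ∈ [1, κ]` there is a `κ'`-smooth norm on `E`
that is `κ / κ'`-compatible with the given one. -/
def IsRegularSpace (E : Type*) [NormedAddCommGroup E] [NormedSpace ℝ E] (κ : ℝ) : Prop :=
  ∃ κ' : ℝ, 1 ≤ κ' ∧ κ' ≤ κ ∧ ∃ q : Seminorm ℝ E, IsSmoothNorm κ' q ∧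
    ∀ x : E, ‖x‖ ^ 2 ≤ q x ^ 2 ∧ q x ^ 2 ≤ κ / κ' * ‖x‖ ^ 2

/-- `ξ 1, ξ 2, …` is an `E`-valued martingale-difference sequence for the filtration `ℱ`
(the value `ξ 0` plays no role).  For finite-dimensional `E`, strong measurability with respect
to `ℱ i` is Borel measurability with respect to `ℱ i`. -/
def IsMartingaleDifference {Ω E : Type*} [mΩ : MeasurableSpace Ω]
    [NormedAddCommGroup E] [NormedSpace ℝ E] [FiniteDimensional ℝ E]
    (μ : Measure Ω) (ℱ : Filtration ℕ mΩ) (ξ : ℕ → Ω → E) : Prop :=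
  haveI : CompleteSpace E := FiniteDimensional.complete ℝ E
  ∀ i : ℕ, StronglyMeasurable[ℱ (i + 1)] (ξ (i + 1)) ∧ Integrable (ξ (i + 1)) μ ∧
    μ[ξ (i + 1) | ℱ i] =ᵐ[μ] 0

/-- The light-tail condition: for every `i ≥ 1`, almost surely
`E_{i-1} exp (‖ξ_i‖ ^ α / σ_i ^ α) ≤ e`.  Integrability is part of the condition, since the
conditional expectation of a nonintegrable function is `0` by convention. -/
def LightTail {Ω E : Type*} [mΩ : MeasurableSpace Ω] [NormedAddCommGroup E]
    (μ : Measure Ω) (ℱ : Filtration ℕ mΩ) (α : ℝ) (σ : ℕ → ℝ) (ξ : ℕ → Ω → E) : Prop :=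
  ∀ i : ℕ,
    Integrable (fun ω => Real.exp (‖ξ (i + 1) ω‖ ^ α / σ (i + 1) ^ α)) μ ∧
    ∀ᵐ ω ∂μ, (μ[fun ω' => Real.exp (‖ξ (i + 1) ω'‖ ^ α / σ (i + 1) ^ α) | ℱ i]) ω ≤ Real.exp 1

/-- The sum `S_N = ξ_1 + … + ξ_N`. -/
def partialSum {Ω E : Type*} [AddCommMonoid E] (ξ : ℕ → Ω → E) (N : ℕ) (ω : Ω) : E :=
  ∑ i ∈ Finset.Icc 1 N, ξ i ω

/-- The vector `σ^N = [σ_1; …; σ_N]`. -/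
def initialVec (σ : ℕ → ℝ) (N : ℕ) : Fin N → ℝ := fun j => σ (j + 1)

/-- The `ℓ_p` norm of a vector with `N` real coordinates. -/
def lpNormVec {N : ℕ} (p : ℝ≥0∞) (ν : Fin N → ℝ) : ℝ := ‖WithLp.toLp p ν‖

/-- The conjugate exponent `α_* = α / (α - 1)`. -/
def conjExp (α : ℝ) : ℝ := α / (α - 1)

/-- The factor `[‖ν‖_2 / ‖ν‖_{α_*}] ^ (α / (2 - α))`, meant for `1 < α < 2`. -/
def normRatio {N : ℕ} (α : ℝ) (ν : Fin N → ℝ) : ℝ :=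
  (lpNormVec 2 ν / lpNormVec (ENNReal.ofReal (conjExp α)) ν) ^ (α / (2 - α))

/-- The formula for `γ_*` in the range `1 < α < 2`. -/
def gammaStarMid {N : ℕ} (α : ℝ) (ν : Fin N → ℝ) : ℝ :=
  32 * (8 * conjExp α / 2 ^ conjExp α) ^ ((α - 1) / (2 - α)) * normRatio α ν

/-- `γ_*(α, ν) ∈ [0, +∞]` for `1 ≤ α ≤ 2`. -/
def gammaStar {N : ℕ} (α : ℝ) (ν : Fin N → ℝ) : ℝ≥0∞ :=
  if α = 1 then ENNReal.ofReal (16 * (lpNormVec 2 ν / lpNormVec ∞ ν))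
  else if α = 2 then ∞
  else ENNReal.ofReal (gammaStarMid α ν)

/-- The finite number `min [γ ^ 2, γ_* ^ (2 - α) * γ ^ α]`, for `γ ≥ 0`.  It is computed in
`[0, +∞]`, where `∞ ^ 0 = 1`, so that it equals `γ ^ 2` for `α = 2`. -/
def tailExponent {N : ℕ} (α : ℝ) (ν : Fin N → ℝ) (γ : ℝ) : ℝ :=
  (min (ENNReal.ofReal γ ^ (2 : ℝ))
    (gammaStar α ν ^ (2 - α) * ENNReal.ofReal γ ^ α)).toReal

end RegularSpace

end

/-! Chernoff's method is applied to a smooth surrogate of the norm. Write `q` for the smooth norm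
given by regularity. The infimal convolution `V` of `‖·‖` with `q ^ 2 / (2 * β)` lies above `‖·‖ - β
/ 2`, is nonpositive at `0`, is 1-Lipschitz for `‖·‖`, and exceeds its linearization by at most `C *
‖h‖ ^ 2`, where `C = κ / (2 * β)` (`exists_smooth_approximation`). The Lipschitz property lets the
tail assumptions on `‖ξ‖` act on increments of `V` without a factor `κ`; the curvature enters only
the shift of the threshold.

The increment `w = V(S_{n+1}) - V(S_n)` satisfies `|w| ≤ ‖ξ_{n+1}‖` and `w ≤ v + C * ‖ξ_{n+1}‖ ^ 2`,
where `v = DV(S_n)[ξ_{n+1}]` has conditional mean zero. A pointwise bound `exp (l * w) ≤ c * v + D`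
therefore bounds the conditional mean of `exp (l * w)` by that of `D`. This is the content of
`StepBound`, and multiplying over the steps gives `integral_exp_partialSum_le`. Markov's inequality
with `β` of order `√κ * ‖σ^N‖₂` then gives the tail bound.

The rest is scalar. Each step costs a curvature term plus a multiple of `(l * σ_i) ^ 2`, and for `1
< α < 2` also `(l * σ_i) ^ α_* / α_*`. Optimizing in `l` turns the square into `γ ^ 2` and, by
Legendre duality, the power `α_*` into `γ ^ α`. For `α = 1` the second term becomes the constraint
`l * σ_i ≤ 1 / 2`. -/

namespace RegularSpace

/-! ### Smooth approximation of the norm by infimal convolution. -/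

section Smoothing

variable {E : Type*} [NormedAddCommGroup E] [NormedSpace ℝ E]

theorem seminorm_sq_smul_add_smul_le (q : Seminorm ℝ E) (a b : E) :
    q ((2⁻¹ : ℝ) • (a + b)) ^ 2 ≤ (q a ^ 2 + q b ^ 2) / 2 := by
  have h1 : q ((2⁻¹ : ℝ) • (a + b)) = 2⁻¹ * q (a + b) := by
    rw [map_smul_eq_mul]; norm_num
  have h2 := map_add_le_add q a b
  have h3 := apply_nonneg q (a + b)
  rw [h1]
  nlinarith [sq_nonneg (q a - q b), apply_nonneg q a, apply_nonneg q b]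

/-- Midpoint convexity reflects the upper bound at `-h` into a lower bound at `h`, so the
linearization error is at most `C * ‖h‖ ^ 2` in absolute value. -/
theorem hasFDerivAt_of_sq_bound {V : E → ℝ} {g : E →L[ℝ] ℝ} {x : E} {C : ℝ}
    (hupper : ∀ h, V (x + h) ≤ V x + g h + C * ‖h‖ ^ 2)
    (hmid : ∀ h, 2 * V x ≤ V (x + h) + V (x - h)) : HasFDerivAt V g x := by
  rw [hasFDerivAt_iff_isLittleO_nhds_zero]
  have hO : (fun h => V (x + h) - V x - g h) =O[𝓝 0] fun h : E => ‖h‖ ^ 2 := by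
    refine Asymptotics.IsBigO.of_bound C (Eventually.of_forall fun h => ?_)
    have h1 := hupper h
    have h2 := hupper (-h)
    have h3 := hmid h
    rw [map_neg, norm_neg, ← sub_eq_add_neg] at h2
    rw [Real.norm_eq_abs, norm_pow, norm_norm, abs_le]
    constructor <;> linarith
  refine hO.trans_isLittleO ?_
  simpa using (Asymptotics.isLittleO_norm_pow_id (E' := E) one_lt_two)

variable [FiniteDimensional ℝ E]

/-- The infimal convolution of the given norm with a multiple of the squared smooth norm. -/
theorem exists_smooth_approximation {κ : ℝ} (hE : IsRegularSpace E κ) {β : ℝ} (hβ : 0 < β) :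
    ∃ V : E → ℝ, (∀ x, ‖x‖ - β / 2 ≤ V x) ∧ V 0 ≤ 0 ∧ (∀ x y, V x ≤ V y + ‖x - y‖) ∧
      ∀ x h, V (x + h) ≤ V x + fderiv ℝ V x h + κ / (2 * β) * ‖h‖ ^ 2 := by
  obtain ⟨κ', hκ', -, q, ⟨-, -, hcd, hq⟩, hcomp⟩ := hE
  have : ProperSpace E := FiniteDimensional.proper_real E
  let F : E → E → ℝ := fun x y => q (x - y) ^ 2 / (2 * β) + ‖y‖
  have hβ2 : 0 < 2 * β := by positivity
  have hex : ∀ x, ∃ y, ∀ z, F x y ≤ F x z := by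
    intro x
    have hc : Continuous (F x) := by
      have := hcd.continuous.comp (continuous_const.sub continuous_id : Continuous fun y : E => x - y)
      exact (this.div_const _).add continuous_norm
    refine hc.exists_forall_le (tendsto_atTop_mono (fun y => ?_) (tendsto_norm_cocompact_atTop (E := E)))
    have : 0 ≤ q (x - y) ^ 2 / (2 * β) := by positivity
    simp only [F]; linarith
  choose Y hY using hex
  let V : E → ℝ := fun x => F x (Y x)
  have hV : ∀ x z, V x ≤ F x z := fun x z => hY x z
  have hmid : ∀ x h, 2 * V x ≤ V (x + h) + V (x - h) := by
    intro x h
    -- The midpoint of the two minimizers is a competitor at `x`; joint convexity of `F` does the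
    -- rest.
    have h1 := hV x ((2⁻¹ : ℝ) • (Y (x + h) + Y (x - h)))
    have h2 := seminorm_sq_smul_add_smul_le q (x + h - Y (x + h)) (x - h - Y (x - h))
    have h3 : (2⁻¹ : ℝ) • (x + h - Y (x + h) + (x - h - Y (x - h)))
        = x - (2⁻¹ : ℝ) • (Y (x + h) + Y (x - h)) := by module
    rw [h3] at h2
    have h4 : ‖(2⁻¹ : ℝ) • (Y (x + h) + Y (x - h))‖ ≤ (‖Y (x + h)‖ + ‖Y (x - h)‖) / 2 := by
      rw [norm_smul]; have := norm_add_le (Y (x + h)) (Y (x - h)); norm_num; linarith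
    have h5 := div_le_div_of_nonneg_right h2 hβ2.le
    have h6 : V (x + h) + V (x - h) = 2 * (((q (x + h - Y (x + h)) ^ 2 +
        q (x - h - Y (x - h)) ^ 2) / 2) / (2 * β)) + (‖Y (x + h)‖ + ‖Y (x - h)‖) := by
      simp only [V, F]; ring
    simp only [F] at h1
    rw [h6]; linarith
  have hup : ∀ x h, V (x + h) ≤ V x +
      ((2 * β)⁻¹ • fderiv ℝ (fun z : E => q z ^ 2) (x - Y x)) h + κ / (2 * β) * ‖h‖ ^ 2 := by
    intro x h
    -- Keeping the minimizer of `x` as competitor at `x + h` transfers the smoothness of `q ^ 2` to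
    -- `V`.
    have h1 := hV (x + h) (Y x)
    have h2 := hq (x - Y x) h
    have h3 : κ' * q h ^ 2 ≤ κ * ‖h‖ ^ 2 := by
      have := mul_le_mul_of_nonneg_left (hcomp h).2 (by linarith : 0 ≤ κ')
      have e : κ' * (κ / κ' * ‖h‖ ^ 2) = κ * ‖h‖ ^ 2 := by field_simp
      linarith
    have h4 : x + h - Y x = x - Y x + h := by abel
    simp only [F] at h1
    rw [h4] at h1
    refine h1.trans ?_
    have h5 : q (x - Y x + h) ^ 2 ≤ q (x - Y x) ^ 2 +
      fderiv ℝ (fun z : E => q z ^ 2) (x - Y x) h + κ * ‖h‖ ^ 2 := by linarith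
    have h6 := div_le_div_of_nonneg_right h5 hβ2.le
    simp only [V, F, smul_apply, smul_eq_mul]
    have h7 : (q (x - Y x) ^ 2 + fderiv ℝ (fun z : E => q z ^ 2) (x - Y x) h + κ * ‖h‖ ^ 2) / (2 * β)
      = q (x - Y x) ^ 2 / (2 * β) + (2 * β)⁻¹ * fderiv ℝ (fun z : E => q z ^ 2) (x - Y x) h
        + κ / (2 * β) * ‖h‖ ^ 2 := by ring
    linarith
  refine ⟨V, fun x => ?_, ?_, fun x y => ?_, fun x h => ?_⟩
  · have h1 : ‖x‖ ≤ ‖x - Y x‖ + ‖Y x‖ := by simpa using norm_add_le (x - Y x) (Y x)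
    have h2 : ‖x - Y x‖ - β / 2 ≤ q (x - Y x) ^ 2 / (2 * β) := by
      rw [le_div_iff₀ hβ2]
      nlinarith [(hcomp (x - Y x)).1, sq_nonneg (‖x - Y x‖ - β)]
    simp only [V, F]; linarith
  · refine (hV 0 0).trans ?_
    simp [F]
  -- The translated minimizer leaves the `q` term unchanged, so only `‖·‖` enters the Lipschitz
  -- bound.
  · refine (hV x (Y y + (x - y))).trans ?_
    have h1 : x - (Y y + (x - y)) = y - Y y := by abel
    have h2 := norm_add_le (Y y) (x - y)
    simp only [V, F, h1]; linarith
  · rw [(hasFDerivAt_of_sq_bound (hup x) (hmid x)).fderiv]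
    exact hup x h

end Smoothing

/-! ### Conditional exponential moments and the Chernoff bound. -/

section Probability

/-- An upper bound `exp b` for the conditional exponential moment of `l * w`, uniformly over the
real increments `w` dominated by `‖X‖` and by a linear term `v` plus `C * ‖X‖ ^ 2`: the exponential
is majorized by a multiple of `v` plus a remainder of conditional mean at most `exp b`. -/
def StepBound {Ω E : Type*} [mΩ : MeasurableSpace Ω] [NormedAddCommGroup E] (μ : Measure Ω)
    (m : MeasurableSpace Ω) (X : Ω → E) (l C b : ℝ) : Prop :=
  ∃ (c : ℝ) (D : Ω → ℝ), Integrable D μ ∧ (∀ᵐ ω ∂μ, (μ[D | m]) ω ≤ Real.exp b) ∧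
    ∀ᵐ ω ∂μ, ∀ v w : ℝ, |w| ≤ ‖X ω‖ → w ≤ v + C * ‖X ω‖ ^ 2 → Real.exp (l * w) ≤ c * v + D ω

theorem IsRegularSpace.one_le {E : Type*} [NormedAddCommGroup E] [NormedSpace ℝ E] {κ : ℝ}
    (hE : IsRegularSpace E κ) : 1 ≤ κ := by
  obtain ⟨κ', h1, h2, -⟩ := hE
  exact h1.trans h2

theorem partialSum_succ {Ω E : Type*} [AddCommMonoid E] (ξ : ℕ → Ω → E) (n : ℕ) (ω : Ω) :
    partialSum ξ (n + 1) ω = partialSum ξ n ω + ξ (n + 1) ω :=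
  Finset.sum_Icc_succ_top (by omega) _

theorem IsMartingaleDifference.stronglyMeasurable_partialSum {Ω E : Type*}
    [mΩ : MeasurableSpace Ω] {μ : Measure Ω} [NormedAddCommGroup E] [NormedSpace ℝ E]
    [FiniteDimensional ℝ E] {ℱ : Filtration ℕ mΩ} {ξ : ℕ → Ω → E}
    (hξ : IsMartingaleDifference μ ℱ ξ) (n : ℕ) : StronglyMeasurable[ℱ n] (partialSum ξ n) := by
  refine Finset.stronglyMeasurable_fun_sum _ fun i hi => ?_
  rw [Finset.mem_Icc] at hi
  obtain ⟨j, rfl⟩ : ∃ j, i = j + 1 := ⟨i - 1, by omega⟩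
  exact (hξ j).1.mono (ℱ.mono hi.2)

/-- A random variable dominated by a predictable linear functional of a centred increment plus a
remainder has the conditional mean of the remainder as an upper bound. -/
theorem condExp_le_of_le_linear_add {Ω E : Type*} [mΩ : MeasurableSpace Ω]
    {μ : Measure Ω} [NormedAddCommGroup E] [NormedSpace ℝ E] [CompleteSpace E]
    {m : MeasurableSpace Ω} (hm : m ≤ mΩ)
    {L : Ω → E →L[ℝ] ℝ} (hL : StronglyMeasurable[m] L) (hL1 : ∀ ω, ‖L ω‖ ≤ 1)
    {X : Ω → E} (hX : Integrable X μ) (hX0 : μ[X | m] =ᵐ[μ] 0)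
    {D : Ω → ℝ} (hD : Integrable D μ) {a : ℝ} (hDa : ∀ᵐ ω ∂μ, (μ[D | m]) ω ≤ a) {c : ℝ}
    {Y : Ω → ℝ} (hY : AEStronglyMeasurable[mΩ] Y μ) (hY0 : ∀ ω, 0 ≤ Y ω)
    (hYle : ∀ᵐ ω ∂μ, Y ω ≤ c * L ω (X ω) + D ω) :
    Integrable Y μ ∧ ∀ᵐ ω ∂μ, (μ[Y | m]) ω ≤ a := by
  have hLX : Integrable (fun ω => L ω (X ω)) μ := by
    refine hX.norm.mono ?_ (Eventually.of_forall fun ω => ?_)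
    · exact (ContinuousLinearMap.apply ℝ ℝ).flip.aestronglyMeasurable_comp₂
        (hL.mono hm).aestronglyMeasurable hX.aestronglyMeasurable
    · simpa using (L ω).le_of_opNorm_le (hL1 ω) (X ω)
  have hLX0 : μ[fun ω => L ω (X ω) | m] =ᵐ[μ] 0 := by
    have := condExp_bilin_of_stronglyMeasurable_left (μ := μ)
      (ContinuousLinearMap.apply ℝ ℝ (E := E)).flip hL (g := X) hLX hX
    refine this.trans ?_
    filter_upwards [hX0] with ω h
    simp [h]
  have hR : Integrable (c • (fun ω => L ω (X ω)) + D) μ := (hLX.smul c).add hD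
  have hYi : Integrable Y μ := by
    refine hR.mono hY ?_
    filter_upwards [hYle] with ω h
    rw [Real.norm_of_nonneg (hY0 ω)]
    exact h.trans (le_abs_self _)
  refine ⟨hYi, ?_⟩
  have h1 : μ[Y | m] ≤ᵐ[μ] μ[c • (fun ω => L ω (X ω)) + D | m] :=
    condExp_mono hYi hR (by filter_upwards [hYle] with ω h using h)
  filter_upwards [h1, condExp_add (hLX.smul c) hD m, condExp_smul (μ := μ) c (fun ω => L ω (X ω)) m,
    hLX0, hDa] with ω g1 g2 g3 g4 g5
  rw [g2, Pi.add_apply, g3, Pi.smul_apply, g4] at g1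
  simp at g1
  linarith

variable {Ω : Type*} [mΩ : MeasurableSpace Ω] {μ : Measure Ω} [IsProbabilityMeasure μ]

/-- Integrability of `M * Y` is not known beforehand, so `M` is truncated at `n`, pulled out of the
conditional expectation, and restored by monotone convergence. -/
theorem integrable_mul_and_integral_mul_le {m : MeasurableSpace Ω} (hm : m ≤ mΩ) {M Y : Ω → ℝ}
    (hM : StronglyMeasurable[m] M) (hM0 : ∀ ω, 0 ≤ M ω) (hMi : Integrable M μ)
    (hY : Integrable Y μ) (hY0 : ∀ ω, 0 ≤ Y ω) {a : ℝ} (ha : 0 ≤ a)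
    (hle : ∀ᵐ ω ∂μ, (μ[Y | m]) ω ≤ a) :
    Integrable (fun ω => M ω * Y ω) μ ∧ ∫ ω, M ω * Y ω ∂μ ≤ a * ∫ ω, M ω ∂μ := by
  let f : ℕ → Ω → ℝ := fun n ω => min (M ω) n
  have hf0 : ∀ n ω, 0 ≤ f n ω := fun n ω => le_min (hM0 ω) n.cast_nonneg
  have hfm : ∀ n, StronglyMeasurable[m] (f n) := fun n => hM.inf stronglyMeasurable_const
  have hfb : ∀ n ω, ‖f n ω‖ ≤ n := fun n ω => by
    rw [Real.norm_of_nonneg (hf0 n ω)]; exact min_le_right _ _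
  have hfY : ∀ n, Integrable (fun ω => f n ω * Y ω) μ := fun n =>
    hY.bdd_mul ((hfm n).mono hm).aestronglyMeasurable (Eventually.of_forall (hfb n))
  have hbound : ∀ n, ∫ ω, f n ω * Y ω ∂μ ≤ a * ∫ ω, M ω ∂μ := by
    intro n
    have h1 := condExp_stronglyMeasurable_mul_of_bound hm (hfm n) hY n (Eventually.of_forall (hfb n))
    calc ∫ ω, f n ω * Y ω ∂μ = ∫ ω, (μ[f n * Y | m]) ω ∂μ := (integral_condExp hm).symm
      _ ≤ ∫ ω, a * M ω ∂μ := by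
        refine integral_mono_ae integrable_condExp (hMi.const_mul a) ?_
        filter_upwards [h1, hle] with ω h2 h3
        rw [h2, Pi.mul_apply, mul_comm]
        exact (mul_le_mul_of_nonneg_right h3 (hf0 n ω)).trans
          (mul_le_mul_of_nonneg_left (min_le_left _ _) ha)
      _ = a * ∫ ω, M ω ∂μ := integral_const_mul _ _
  have hlim : Tendsto (fun n => ∫⁻ ω, ENNReal.ofReal (f n ω * Y ω) ∂μ) atTop
      (𝓝 (∫⁻ ω, ENNReal.ofReal (M ω * Y ω) ∂μ)) := by
    refine lintegral_tendsto_of_tendsto_of_monotone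
      (fun n => (hfY n).aestronglyMeasurable.aemeasurable.ennreal_ofReal)
      (Eventually.of_forall fun ω n k hnk => ENNReal.ofReal_le_ofReal
        (mul_le_mul_of_nonneg_right (min_le_min le_rfl (Nat.cast_le.2 hnk)) (hY0 ω)))
      (Eventually.of_forall fun ω => ?_)
    obtain ⟨k, hk⟩ := exists_nat_ge (M ω)
    refine tendsto_const_nhds.congr' ?_
    filter_upwards [eventually_ge_atTop k] with n hn
    have : f n ω = M ω := min_eq_left (hk.trans (Nat.cast_le.2 hn))
    rw [this]
  have hlint : ∫⁻ ω, ENNReal.ofReal (M ω * Y ω) ∂μ ≤ ENNReal.ofReal (a * ∫ ω, M ω ∂μ) := by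
    refine le_of_tendsto' hlim fun n => ?_
    rw [← ofReal_integral_eq_lintegral_ofReal (hfY n)
      (Eventually.of_forall fun ω => mul_nonneg (hf0 n ω) (hY0 ω))]
    exact ENNReal.ofReal_le_ofReal (hbound n)
  have hint : Integrable (fun ω => M ω * Y ω) μ := by
    refine ⟨(hM.mono hm).aestronglyMeasurable.mul hY.aestronglyMeasurable, ?_⟩
    rw [hasFiniteIntegral_iff_ofReal (Eventually.of_forall fun ω => mul_nonneg (hM0 ω) (hY0 ω))]
    exact hlint.trans_lt ENNReal.ofReal_lt_top
  refine ⟨hint, ?_⟩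
  rw [← ofReal_integral_eq_lintegral_ofReal hint
    (Eventually.of_forall fun ω => mul_nonneg (hM0 ω) (hY0 ω))] at hlint
  exact (ENNReal.ofReal_le_ofReal_iff (mul_nonneg ha (integral_nonneg hM0))).1 hlint

variable {E : Type*} [NormedAddCommGroup E] [NormedSpace ℝ E] [FiniteDimensional ℝ E]

theorem integral_exp_partialSum_le {ℱ : Filtration ℕ mΩ} {ξ : ℕ → Ω → E}
    (hξ : IsMartingaleDifference μ ℱ ξ) {V : E → ℝ} (hV0 : V 0 ≤ 0)
    (hVL : ∀ x y, V x ≤ V y + ‖x - y‖) {C : ℝ}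
    (hVC : ∀ x h, V (x + h) ≤ V x + fderiv ℝ V x h + C * ‖h‖ ^ 2)
    {l : ℝ} (hl : 0 ≤ l) {b : ℕ → ℝ} {N : ℕ}
    (hstep : ∀ i < N, StepBound μ (ℱ i) (ξ (i + 1)) l C (b i)) :
    Integrable (fun ω => Real.exp (l * V (partialSum ξ N ω))) μ ∧
      ∫ ω, Real.exp (l * V (partialSum ξ N ω)) ∂μ ≤ Real.exp (∑ i ∈ Finset.range N, b i) := by
  have : CompleteSpace E := FiniteDimensional.complete ℝ E
  borelize E
  have hVl : LipschitzWith 1 V := LipschitzWith.of_le_add fun x y => by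
    rw [dist_eq_norm]; exact hVL x y
  induction N with
  | zero =>
    simp only [partialSum, Finset.Icc_eq_empty_of_lt zero_lt_one, Finset.sum_empty,
      Finset.range_zero, Real.exp_zero]
    refine ⟨integrable_const _, ?_⟩
    simpa using mul_nonpos_of_nonneg_of_nonpos hl hV0
  | succ n ih =>
    obtain ⟨ih1, ih2⟩ := ih fun i hi => hstep i (hi.trans n.lt_succ_self)
    obtain ⟨c, D, hD, hDb, hc⟩ := hstep n n.lt_succ_self
    have hS := hξ.stronglyMeasurable_partialSum n
    have hS' := (hξ.stronglyMeasurable_partialSum (n + 1)).mono (ℱ.le (n + 1))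
    -- Writing the slope as `fderiv` makes it measurable without a measurable choice of minimizers.
    have hL : StronglyMeasurable[ℱ n] fun ω => fderiv ℝ V (partialSum ξ n ω) :=
      ((measurable_fderiv ℝ V).comp hS.measurable).stronglyMeasurable
    let Y : Ω → ℝ := fun ω => Real.exp (l * (V (partialSum ξ (n + 1) ω) - V (partialSum ξ n ω)))
    have hYm : AEStronglyMeasurable Y μ := by
      refine (Real.continuous_exp.comp_stronglyMeasurable (StronglyMeasurable.const_mul
        (StronglyMeasurable.sub ?_ ?_) l)).aestronglyMeasurable
      · exact hVl.continuous.comp_stronglyMeasurable hS'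
      · exact hVl.continuous.comp_stronglyMeasurable (hS.mono (ℱ.le n))
    obtain ⟨hYi, hYa⟩ := condExp_le_of_le_linear_add (ℱ.le n) hL
      (fun ω => by simpa using norm_fderiv_le_of_lipschitz ℝ hVl) (hξ n).2.1 (hξ n).2.2 hD hDb
      (c := c) (Y := Y) hYm (fun ω => (Real.exp_pos _).le) (by
        filter_upwards [hc] with ω h
        refine h _ _ ?_ ?_
        · rw [partialSum_succ, abs_le]
          have h1 := hVL (partialSum ξ n ω + ξ (n + 1) ω) (partialSum ξ n ω)
          have h2 := hVL (partialSum ξ n ω) (partialSum ξ n ω + ξ (n + 1) ω)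
          rw [add_sub_cancel_left] at h1
          rw [sub_add_cancel_left, norm_neg] at h2
          constructor <;> linarith
        · rw [partialSum_succ]
          have := hVC (partialSum ξ n ω) (ξ (n + 1) ω)
          linarith)
    have hM : StronglyMeasurable[ℱ n] fun ω => Real.exp (l * V (partialSum ξ n ω)) :=
      Real.continuous_exp.comp_stronglyMeasurable
        ((hVl.continuous.comp_stronglyMeasurable hS).const_mul l)
    obtain ⟨h1, h2⟩ := integrable_mul_and_integral_mul_le (ℱ.le n) hM
      (fun ω => (Real.exp_pos _).le) ih1 hYi (fun ω => (Real.exp_pos _).le) (Real.exp_pos _).le hYa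
    have he : ∀ ω, Real.exp (l * V (partialSum ξ n ω)) * Y ω
        = Real.exp (l * V (partialSum ξ (n + 1) ω)) := fun ω => by
      rw [← Real.exp_add]; congr 1; ring
    simp only [he] at h1 h2
    refine ⟨h1, h2.trans ?_⟩
    rw [Finset.sum_range_succ, add_comm, Real.exp_add]
    exact mul_le_mul_of_nonneg_left ih2 (Real.exp_pos _).le

theorem measure_norm_partialSum_ge_le {κ : ℝ} (hE : IsRegularSpace E κ)
    {ℱ : Filtration ℕ mΩ} {ξ : ℕ → Ω → E} (hξ : IsMartingaleDifference μ ℱ ξ) {β : ℝ} (hβ : 0 < β)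
    {l : ℝ} (hl : 0 ≤ l) {b : ℕ → ℝ} {N : ℕ}
    (hstep : ∀ i < N, StepBound μ (ℱ i) (ξ (i + 1)) l (κ / (2 * β)) (b i)) (r : ℝ) :
    μ.real {ω | r ≤ ‖partialSum ξ N ω‖} ≤
      Real.exp (-l * r + l * β / 2 + ∑ i ∈ Finset.range N, b i) := by
  obtain ⟨V, hV1, hV0, hVL, hVC⟩ := exists_smooth_approximation hE hβ
  obtain ⟨h1, h2⟩ := integral_exp_partialSum_le hξ hV0 hVL hVC hl hstep
  calc μ.real {ω | r ≤ ‖partialSum ξ N ω‖}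
      ≤ μ.real {ω | r - β / 2 ≤ V (partialSum ξ N ω)} :=
        measureReal_mono fun ω (h : r ≤ _) =>
          (sub_le_sub_right h (β / 2)).trans (hV1 (partialSum ξ N ω))
    _ ≤ Real.exp (-l * (r - β / 2)) * ∫ ω, Real.exp (l * V (partialSum ξ N ω)) ∂μ :=
        ProbabilityTheory.measure_ge_le_exp_mul_mgf _ hl h1
    _ ≤ Real.exp (-l * (r - β / 2)) * Real.exp (∑ i ∈ Finset.range N, b i) :=
        mul_le_mul_of_nonneg_left h2 (Real.exp_pos _).le
    _ = _ := by rw [← Real.exp_add]; congr 1; ring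

end Probability

/-! ### Elementary inequalities for the exponential. -/

section ScalarBounds

theorem exp_le_add_exp_sq (x : ℝ) : Real.exp x ≤ x + Real.exp (x ^ 2) := by
  have h := Real.add_one_le_exp (x ^ 2)
  rcases le_or_gt |x| 1 with hx | hx
  · have := (abs_le.1 (Real.abs_exp_sub_one_sub_id_le hx)).2
    linarith
  · rcases lt_abs.1 hx with h1 | h1
    · have : Real.exp x ≤ Real.exp (x ^ 2) := Real.exp_le_exp.2 (by nlinarith)
      linarith
    · have : Real.exp x ≤ 1 := Real.exp_le_one_iff.2 (by linarith)
      nlinarith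

/-- The right side is the tangent at `u = e` to the concave function `u ^ θ`, with `u = exp y`. If
`u` has conditional mean at most `e`, the tangent has conditional mean at most `exp θ`. -/
theorem exp_mul_le_tangent {θ y : ℝ} (hθ0 : 0 ≤ θ) (hθ1 : θ ≤ 1) :
    Real.exp (θ * y) ≤
      Real.exp θ * (1 - θ) + θ * Real.exp θ / Real.exp 1 * Real.exp y := by
  have h := rpow_one_add_le_one_add_mul_self (s := Real.exp (y - 1) - 1)
    (by linarith [Real.exp_pos (y - 1)]) hθ0 hθ1
  rw [add_sub_cancel, ← Real.exp_mul] at h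
  have h1 : Real.exp (θ * y) = Real.exp θ * Real.exp ((y - 1) * θ) := by
    rw [← Real.exp_add]; congr 1; ring
  rw [h1]
  refine (mul_le_mul_of_nonneg_left h (Real.exp_pos θ).le).trans (le_of_eq ?_)
  rw [Real.exp_sub]
  field_simp
  ring

theorem sq_le_mul_exp_half {x : ℝ} (hx : 0 ≤ x) : x ^ 2 ≤ 11 / 5 * Real.exp (x / 2) := by
  have h1 := Real.add_one_le_exp (x / 4 - 1)
  have h2 : Real.exp (x / 4) = Real.exp (x / 4 - 1) * Real.exp 1 := by
    rw [← Real.exp_add]; congr 1; ring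
  have h3 : Real.exp (x / 2) = Real.exp (x / 4) ^ 2 := by
    rw [← Real.exp_nat_mul]; congr 1; push_cast; ring
  have h4 := Real.exp_one_gt_d9
  -- From `exp (x / 4) ≥ e * x / 4` and `e > 2.7`; then `(40 / 27) ^ 2 < 11 / 5`.
  have h5 : 27 / 40 * x ≤ Real.exp (x / 4) := by rw [h2]; nlinarith
  rw [h3]
  nlinarith

theorem exp_le_one_add_add_sq_mul_exp_abs (x : ℝ) :
    Real.exp x ≤ 1 + x + x ^ 2 * Real.exp |x| := by
  have h := Complex.norm_exp_sub_sum_le_norm_mul_exp x 2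
  simp only [Finset.sum_range_succ, Finset.sum_range_zero, pow_zero, pow_one, Nat.factorial,
    Nat.cast_one, div_one, zero_add, mul_one, Complex.norm_real, Real.norm_eq_abs, sq_abs] at h
  rw [← Complex.ofReal_exp, ← Complex.ofReal_one, ← Complex.ofReal_add, ← Complex.ofReal_sub,
    Complex.norm_real, Real.norm_eq_abs] at h
  have := (abs_le.1 h).2
  linarith

variable {α y : ℝ}

theorem exp_le_exp_rpow_and_one_le (hα : 1 ≤ α) (hy : 0 ≤ y) :
    (1 ≤ y → Real.exp y ≤ Real.exp (y ^ α)) ∧ 1 ≤ Real.exp (y ^ α) := by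
  refine ⟨fun h => Real.exp_le_exp.2 ?_, Real.one_le_exp (Real.rpow_nonneg hy α)⟩
  simpa using Real.rpow_le_rpow_of_exponent_le h hα

theorem sq_le_exp_rpow (hα : 1 ≤ α) (hy : 0 ≤ y) : y ^ 2 ≤ Real.exp (y ^ α) := by
  obtain ⟨h1, h2⟩ := exp_le_exp_rpow_and_one_le hα hy
  rcases le_total y 1 with h | h
  · nlinarith
  · refine le_trans ?_ (h1 h)
    have h3 := Real.add_one_le_exp (y / 2 - 1)
    have h4 : Real.exp y = (Real.exp (y / 2 - 1) * Real.exp 1) ^ 2 := by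
      rw [← Real.exp_add, ← Real.exp_nat_mul]; congr 1; push_cast; ring
    have h5 := Real.exp_one_gt_two
    rw [h4]
    have : y ≤ Real.exp (y / 2 - 1) * Real.exp 1 := by nlinarith
    nlinarith

theorem sq_mul_exp_half_le (hα : 1 ≤ α) (hy : 0 ≤ y) :
    y ^ 2 * Real.exp (y / 2) ≤ 11 / 5 * Real.exp (y ^ α) := by
  obtain ⟨h1, h2⟩ := exp_le_exp_rpow_and_one_le hα hy
  rcases le_total y 1 with h | h
  · have h3 : Real.exp (y / 2) ≤ 11 / 5 := by
      have e1 : Real.exp (y / 2) ^ 2 ≤ Real.exp 1 := by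
        rw [← Real.exp_nat_mul]; exact Real.exp_le_exp.2 (by push_cast; linarith)
      nlinarith [Real.exp_one_lt_three]
    have h5 : y ^ 2 ≤ 1 := by nlinarith
    have := mul_le_mul h5 h3 (Real.exp_pos _).le zero_le_one
    linarith
  · have h3 := sq_le_mul_exp_half hy
    have h4 : Real.exp y = Real.exp (y / 2) * Real.exp (y / 2) := by
      rw [← Real.exp_add]; congr 1; ring
    have h5 := mul_le_mul_of_nonneg_right h3 (Real.exp_pos (y / 2)).le
    have := h1 h
    linarith

theorem mul_le_rpow_add_rpow_div (hα : 1 < α) (hy : 0 ≤ y) {t : ℝ} (ht : 0 ≤ t) :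
    t * y ≤ y ^ α + t ^ conjExp α / conjExp α := by
  have hpq : α.HolderConjugate (conjExp α) := Real.HolderConjugate.conjExponent hα
  have h := Real.young_inequality_of_nonneg hy ht hpq
  have h1 : y ^ α / α ≤ y ^ α := div_le_self (Real.rpow_nonneg hy α) hα.le
  linarith [mul_comm y t]

end ScalarBounds

/-! ### One-step bounds under each tail assumption. -/

section StepBounds

variable {Ω E : Type*} {m : MeasurableSpace Ω} [mΩ : MeasurableSpace Ω] {μ : Measure Ω}
  [IsProbabilityMeasure μ]
  [NormedAddCommGroup E] {X : Ω → E} {l C s : ℝ}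

theorem integrable_and_condExp_affine_le (hm : m ≤ mΩ) {Z : Ω → ℝ} (hZ : Integrable Z μ) {a : ℝ}
    (hZa : ∀ᵐ ω ∂μ, (μ[Z | m]) ω ≤ a) (c₀ : ℝ) {c₁ : ℝ} (hc₁ : 0 ≤ c₁) :
    Integrable (fun ω => c₀ + c₁ * Z ω) μ ∧
      ∀ᵐ ω ∂μ, (μ[fun ω => c₀ + c₁ * Z ω | m]) ω ≤ c₀ + c₁ * a := by
  have h1 : Integrable (c₁ • Z) μ := hZ.smul c₁
  refine ⟨(integrable_const c₀).add h1, ?_⟩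
  filter_upwards [condExp_add (integrable_const c₀) h1 m, condExp_smul (μ := μ) c₁ Z m, hZa]
    with ω g1 g2 g3
  change (μ[(fun _ => c₀) + c₁ • Z | m]) ω ≤ _
  rw [g1, Pi.add_apply, g2, condExp_const hm]
  simpa using mul_le_mul_of_nonneg_left g3 hc₁

theorem stepBound_of_norm_le (hm : m ≤ mΩ) (hl : 0 ≤ l) (hC : 0 ≤ C)
    (hX : ∀ᵐ ω ∂μ, ‖X ω‖ ≤ s) : StepBound μ m X l C (l * C * s ^ 2 + (l * s) ^ 2) := by
  refine ⟨l, fun _ => l * C * s ^ 2 + Real.exp ((l * s) ^ 2), integrable_const _, ?_, ?_⟩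
  · rw [condExp_const hm]
    refine Eventually.of_forall fun ω => ?_
    have h1 : 0 ≤ l * C * s ^ 2 := by positivity
    have h2 := Real.add_one_le_exp (l * C * s ^ 2)
    have h3 := Real.one_le_exp (sq_nonneg (l * s))
    rw [Real.exp_add]
    nlinarith
  · filter_upwards [hX] with ω hω v w hw hwv
    have h1 := exp_le_add_exp_sq (l * w)
    have h2 : (l * w) ^ 2 ≤ (l * s) ^ 2 := by
      rw [mul_pow, mul_pow]
      exact mul_le_mul_of_nonneg_left (sq_le_sq.2 ((hw.trans hω).trans (le_abs_self s)))
        (sq_nonneg l)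
    have h3 := Real.exp_le_exp.2 h2
    have h4 : w ≤ v + C * s ^ 2 := hwv.trans (by gcongr)
    have h5 := mul_le_mul_of_nonneg_left h4 hl
    linarith

/-- For `l * s ≤ 1` the tangent bound applies with `θ = (l * s) ^ 2`. For `l * s > 1`, with `t = l *
s` and `z = ‖X‖ / s`, the inequality `t * z ≤ t ^ 2 / 4 + z ^ 2` gives the exponent `1 + t ^ 2 / 4 ≤
5 / 4 * t ^ 2`. -/
theorem stepBound_of_condExp_exp_sq_le (hm : m ≤ mΩ) (hl : 0 ≤ l) (hC : 0 ≤ C) (hs : 0 < s)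
    (hZ : Integrable (fun ω => Real.exp (‖X ω‖ ^ (2 : ℝ) / s ^ (2 : ℝ))) μ)
    (hZe : ∀ᵐ ω ∂μ, (μ[fun ω => Real.exp (‖X ω‖ ^ (2 : ℝ) / s ^ (2 : ℝ)) | m]) ω ≤ Real.exp 1) :
    StepBound μ m X l C (l * C * s ^ 2 + 5 / 4 * (l * s) ^ 2) := by
  simp only [Real.rpow_two] at hZ hZe
  have hu : 0 ≤ l * C * s ^ 2 := by positivity
  have ht : 0 ≤ l * s := by positivity
  rcases le_or_gt (l * s) 1 with h1 | h1
  · have hθ0 := sq_nonneg (l * s)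
    have hθ1 : (l * s) ^ 2 ≤ 1 := by nlinarith
    set θ := (l * s) ^ 2 with hθ
    have hc₁ : 0 ≤ (l * C * s ^ 2 + θ * Real.exp θ) / Real.exp 1 := by positivity
    obtain ⟨g1, g2⟩ := integrable_and_condExp_affine_le hm hZ hZe (Real.exp θ * (1 - θ)) hc₁
    refine ⟨l, _, g1, g2.mono fun ω hω => hω.trans ?_, Eventually.of_forall fun ω v w hw hwv => ?_⟩
    · rw [div_mul_cancel₀ _ (Real.exp_pos 1).ne']
      have h2 := Real.add_one_le_exp (l * C * s ^ 2)
      have h3 := Real.one_le_exp hθ0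
      have h4 : Real.exp (l * C * s ^ 2 + θ) ≤ Real.exp (l * C * s ^ 2 + 5 / 4 * θ) :=
        Real.exp_le_exp.2 (by linarith)
      rw [Real.exp_add] at h4
      nlinarith
    · have h2 := exp_le_add_exp_sq (l * w)
      set y := ‖X ω‖ ^ 2 / s ^ 2 with hy
      have hyX : ‖X ω‖ ^ 2 = s ^ 2 * y := by rw [hy]; field_simp
      have h3 : (l * w) ^ 2 ≤ θ * y := by
        have : w ^ 2 ≤ ‖X ω‖ ^ 2 := sq_le_sq.2 (hw.trans (le_abs_self _))
        calc (l * w) ^ 2 = l ^ 2 * w ^ 2 := by ring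
          _ ≤ l ^ 2 * (s ^ 2 * y) := by rw [← hyX]; gcongr
          _ = θ * y := by rw [hθ]; ring
      have h4 := (Real.exp_le_exp.2 h3).trans (exp_mul_le_tangent (y := y) hθ0 hθ1)
      have h5 : y ≤ Real.exp y / Real.exp 1 := by
        rw [← Real.exp_sub]; linarith [Real.add_one_le_exp (y - 1)]
      have h6 : l * w ≤ l * v + l * C * s ^ 2 * (Real.exp y / Real.exp 1) := by
        have e1 := mul_le_mul_of_nonneg_left hwv hl
        have e2 := mul_le_mul_of_nonneg_left h5 hu
        rw [hyX] at e1
        linarith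
      have h7 : (l * C * s ^ 2 + θ * Real.exp θ) / Real.exp 1 * Real.exp y =
        l * C * s ^ 2 * (Real.exp y / Real.exp 1) + θ * Real.exp θ / Real.exp 1 * Real.exp y := by
        ring
      linarith
  · obtain ⟨g1, g2⟩ := integrable_and_condExp_affine_le hm hZ hZe 0
      (Real.exp_pos ((l * s) ^ 2 / 4)).le
    refine ⟨0, _, g1, g2.mono fun ω hω => hω.trans ?_, Eventually.of_forall fun ω v w hw hwv => ?_⟩
    · rw [zero_add, ← Real.exp_add, Real.exp_le_exp]
      nlinarith
    · rw [zero_mul, zero_add, zero_add, ← Real.exp_add, Real.exp_le_exp]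
      have h2 : l * w ≤ (l * s) * (‖X ω‖ / s) := by
        have := mul_le_mul_of_nonneg_left ((le_abs_self w).trans hw) hl
        have e : (l * s) * (‖X ω‖ / s) = l * ‖X ω‖ := by field_simp
        linarith
      have h3 := sq_nonneg (l * s / 2 - ‖X ω‖ / s)
      rw [← div_pow]
      nlinarith

theorem stepBound_of_condExp_exp_rpow_le_of_le (hm : m ≤ mΩ) (hl : 0 ≤ l) (hC : 0 ≤ C) (hs : 0 < s)
    {α : ℝ} (hα : 1 ≤ α) (hls : l * s ≤ 1 / 2)
    (hZ : Integrable (fun ω => Real.exp (‖X ω‖ ^ α / s ^ α)) μ)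
    (hZe : ∀ᵐ ω ∂μ, (μ[fun ω => Real.exp (‖X ω‖ ^ α / s ^ α) | m]) ω ≤ Real.exp 1) :
    StepBound μ m X l C (l * C * (Real.exp 1 * s ^ 2) + 6 * (l * s) ^ 2) := by
  have hu : 0 ≤ l * C * s ^ 2 := by positivity
  have hc₁ : 0 ≤ l * C * s ^ 2 + 11 / 5 * (l * s) ^ 2 := by positivity
  obtain ⟨g1, g2⟩ := integrable_and_condExp_affine_le hm hZ hZe 1 hc₁
  refine ⟨l, _, g1, g2.mono fun ω hω => hω.trans ?_, Eventually.of_forall fun ω v w hw hwv => ?_⟩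
  · have h1 := Real.add_one_le_exp (l * C * (Real.exp 1 * s ^ 2) + 6 * (l * s) ^ 2)
    -- The coefficient `6` comes from `11 / 5 * e < 6`.
    have h2 := Real.exp_one_lt_d9
    have h3 := sq_nonneg (l * s)
    nlinarith
  · set y := ‖X ω‖ / s with hy
    have hy0 : 0 ≤ y := by positivity
    have hyX : ‖X ω‖ = s * y := by rw [hy]; field_simp
    rw [← Real.div_rpow (norm_nonneg _) hs.le, ← hy]
    have h1 := sq_le_exp_rpow hα hy0
    have h2 := sq_mul_exp_half_le hα hy0
    have h3 := exp_le_one_add_add_sq_mul_exp_abs (l * w)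
    have h4 : |l * w| ≤ (l * s) * y := by
      rw [abs_mul, abs_of_nonneg hl]
      refine (mul_le_mul_of_nonneg_left hw hl).trans (le_of_eq ?_)
      rw [hyX]; ring
    have h5 : (l * w) ^ 2 ≤ (l * s) ^ 2 * y ^ 2 := by
      rw [← mul_pow]
      exact sq_le_sq.2 (h4.trans (le_abs_self _))
    have h6 : Real.exp |l * w| ≤ Real.exp (y / 2) := Real.exp_le_exp.2 (h4.trans (by nlinarith))
    have h7 : (l * w) ^ 2 * Real.exp |l * w| ≤ 11 / 5 * (l * s) ^ 2 * Real.exp (y ^ α) := by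
      calc (l * w) ^ 2 * Real.exp |l * w|
          ≤ ((l * s) ^ 2 * y ^ 2) * Real.exp (y / 2) := by gcongr
        _ = (l * s) ^ 2 * (y ^ 2 * Real.exp (y / 2)) := by ring
        _ ≤ (l * s) ^ 2 * (11 / 5 * Real.exp (y ^ α)) := by gcongr
        _ = _ := by ring
    have h8 : l * w ≤ l * v + l * C * s ^ 2 * Real.exp (y ^ α) := by
      have e1 := mul_le_mul_of_nonneg_left hwv hl
      have e2 := mul_le_mul_of_nonneg_left h1 hu
      rw [hyX] at e1
      linarith
    linarith

/-- Beyond `l * s = 1 / 2` Young's inequality replaces the Taylor bound; the resulting extra `1` in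
the exponent is absorbed by `6 * (l * s) ^ 2`. -/
theorem stepBound_of_condExp_exp_rpow_le (hm : m ≤ mΩ) (hl : 0 ≤ l) (hC : 0 ≤ C) (hs : 0 < s)
    {α : ℝ} (hα : 1 < α) (hZ : Integrable (fun ω => Real.exp (‖X ω‖ ^ α / s ^ α)) μ)
    (hZe : ∀ᵐ ω ∂μ, (μ[fun ω => Real.exp (‖X ω‖ ^ α / s ^ α) | m]) ω ≤ Real.exp 1) :
    StepBound μ m X l C (l * C * (Real.exp 1 * s ^ 2) +
      (6 * (l * s) ^ 2 + (l * s) ^ conjExp α / conjExp α)) := by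
  have hq : 0 < conjExp α := div_pos (by linarith) (by linarith)
  have ht : 0 ≤ l * s := by positivity
  have hr : 0 ≤ (l * s) ^ conjExp α / conjExp α := div_nonneg (Real.rpow_nonneg ht _) hq.le
  rcases le_or_gt (l * s) (1 / 2) with h1 | h1
  · obtain ⟨c, D, g1, g2, g3⟩ := stepBound_of_condExp_exp_rpow_le_of_le hm hl hC hs hα.le h1 hZ hZe
    exact ⟨c, D, g1, g2.mono fun ω hω => hω.trans (Real.exp_le_exp.2 (by linarith)), g3⟩
  · obtain ⟨g1, g2⟩ := integrable_and_condExp_affine_le hm hZ hZe 0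
      (Real.exp_pos ((l * s) ^ conjExp α / conjExp α)).le
    refine ⟨0, _, g1, g2.mono fun ω hω => hω.trans ?_, Eventually.of_forall fun ω v w hw hwv => ?_⟩
    · rw [zero_add, ← Real.exp_add, Real.exp_le_exp]
      have : 0 ≤ l * C * (Real.exp 1 * s ^ 2) := by positivity
      nlinarith
    · rw [zero_mul, zero_add, zero_add, ← Real.exp_add, Real.exp_le_exp,
        ← Real.div_rpow (norm_nonneg _) hs.le]
      have h2 := mul_le_rpow_add_rpow_div hα (div_nonneg (norm_nonneg (X ω)) hs.le) ht
      have h3 := mul_le_mul_of_nonneg_left ((le_abs_self w).trans hw) hl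
      have e : (l * s) * (‖X ω‖ / s) = l * ‖X ω‖ := by field_simp
      linarith

end StepBounds

/-! ### Comparison and limits of `ℓ_p` norms. -/

section LpNorms

variable {N : ℕ} (ν : Fin N → ℝ)

theorem lpNormVec_nonneg_ofReal {q : ℝ} (hq : 0 < q) : 0 ≤ lpNormVec (ENNReal.ofReal q) ν := by
  rw [lpNormVec, PiLp.norm_eq_sum (by rwa [ENNReal.toReal_ofReal hq.le])]
  exact Real.rpow_nonneg (Finset.sum_nonneg fun j _ => Real.rpow_nonneg (norm_nonneg _) _) _

theorem lpNormVec_ofReal_rpow {q : ℝ} (hq : 0 < q) :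
    lpNormVec (ENNReal.ofReal q) ν ^ q = ∑ j, |ν j| ^ q := by
  rw [lpNormVec, PiLp.norm_eq_sum (by rwa [ENNReal.toReal_ofReal hq.le]),
    ENNReal.toReal_ofReal hq.le, ← Real.rpow_mul, one_div_mul_cancel hq.ne', Real.rpow_one]
  · rfl
  · exact Finset.sum_nonneg fun j _ => Real.rpow_nonneg (norm_nonneg _) _

theorem lpNormVec_two : lpNormVec 2 ν = √(∑ j, ν j ^ 2) := by
  rw [lpNormVec, EuclideanSpace.norm_eq]
  simp

theorem abs_le_lpNormVec_two (j : Fin N) : |ν j| ≤ lpNormVec 2 ν := by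
  rw [lpNormVec_two]
  refine Real.abs_le_sqrt ?_
  exact Finset.single_le_sum (f := fun j => ν j ^ 2) (fun i _ => sq_nonneg _) (Finset.mem_univ j)

theorem abs_le_lpNormVec_top (j : Fin N) : |ν j| ≤ lpNormVec ∞ ν := by
  rw [lpNormVec, PiLp.norm_eq_ciSup]
  exact le_ciSup (f := fun i => ‖ν i‖) (Set.finite_range _).bddAbove j

theorem exists_lpNormVec_top_eq [Nonempty (Fin N)] : ∃ j, lpNormVec ∞ ν = |ν j| := by
  obtain ⟨j, hj⟩ := exists_eq_ciSup_of_finite (f := fun i => ‖ν i‖)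
  exact ⟨j, hj.symm⟩

theorem lpNormVec_le_lpNormVec_two {q : ℝ} (hq : 2 ≤ q) :
    lpNormVec (ENNReal.ofReal q) ν ≤ lpNormVec 2 ν := by
  have hq0 : 0 < q := by linarith
  have hM : 0 ≤ lpNormVec 2 ν := by rw [lpNormVec_two]; positivity
  rw [← Real.rpow_le_rpow_iff (lpNormVec_nonneg_ofReal ν hq0) hM hq0, lpNormVec_ofReal_rpow ν hq0]
  have h2 : lpNormVec 2 ν ^ 2 = ∑ j, ν j ^ 2 := by
    rw [lpNormVec_two, Real.sq_sqrt (Finset.sum_nonneg fun i _ => sq_nonneg _)]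
  have hsplit : ∀ x : ℝ, 0 ≤ x → x ^ q = x ^ (q - 2) * x ^ 2 := fun x hx => by
    rw [← Real.rpow_natCast x 2, ← Real.rpow_add_of_nonneg hx (by linarith) (by norm_num)]
    norm_num
  rw [hsplit _ hM, h2, Finset.mul_sum]
  refine Finset.sum_le_sum fun j _ => ?_
  rw [hsplit _ (abs_nonneg _), sq_abs]
  exact mul_le_mul_of_nonneg_right (Real.rpow_le_rpow (abs_nonneg _) (abs_le_lpNormVec_two ν j)
    (by linarith)) (sq_nonneg _)

theorem tendsto_lpNormVec_atTop [Nonempty (Fin N)] :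
    Tendsto (fun q : ℝ => lpNormVec (ENNReal.ofReal q) ν) atTop (𝓝 (lpNormVec ∞ ν)) := by
  obtain ⟨j, hj⟩ := exists_lpNormVec_top_eq ν
  have hM : 0 ≤ lpNormVec ∞ ν := hj ▸ abs_nonneg _
  have hN : (0 : ℝ) < N := by
    have := Fin.pos_iff_nonempty.2 ‹Nonempty (Fin N)›
    exact_mod_cast this
  -- Squeeze: `‖ν‖_∞ ≤ ‖ν‖_q ≤ N ^ (1 / q) * ‖ν‖_∞`.
  have hup : Tendsto (fun q : ℝ => (N : ℝ) ^ q⁻¹ * lpNormVec ∞ ν) atTop (𝓝 (lpNormVec ∞ ν)) := by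
    have h := (Real.continuousAt_const_rpow (a := (N : ℝ)) (b := 0) hN.ne').tendsto.comp
      tendsto_inv_atTop_zero
    simpa using h.mul_const (lpNormVec ∞ ν)
  refine tendsto_of_tendsto_of_tendsto_of_le_of_le' tendsto_const_nhds hup ?_ ?_
  · filter_upwards [eventually_gt_atTop 0] with q hq
    rw [← Real.rpow_le_rpow_iff hM (lpNormVec_nonneg_ofReal ν hq) hq, lpNormVec_ofReal_rpow ν hq, hj]
    exact Finset.single_le_sum (f := fun j => |ν j| ^ q)
      (fun i _ => Real.rpow_nonneg (abs_nonneg _) _) (Finset.mem_univ j)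
  · filter_upwards [eventually_gt_atTop 0] with q hq
    have h0 : 0 ≤ (N : ℝ) ^ q⁻¹ := Real.rpow_nonneg hN.le _
    rw [← Real.rpow_le_rpow_iff (lpNormVec_nonneg_ofReal ν hq) (mul_nonneg h0 hM) hq,
      lpNormVec_ofReal_rpow ν hq, Real.mul_rpow h0 hM, ← Real.rpow_mul hN.le,
      inv_mul_cancel₀ hq.ne', Real.rpow_one]
    calc ∑ j, |ν j| ^ q ≤ ∑ _j : Fin N, lpNormVec ∞ ν ^ q := Finset.sum_le_sum fun i _ =>
          Real.rpow_le_rpow (abs_nonneg _) (abs_le_lpNormVec_top ν i) hq.le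
      _ = N * lpNormVec ∞ ν ^ q := by simp

variable {ν}

theorem lpNormVec_ofReal_pos [Nonempty (Fin N)] (hν : ∀ j, 0 < ν j) {q : ℝ} (hq : 0 < q) :
    0 < lpNormVec (ENNReal.ofReal q) ν := by
  refine (lpNormVec_nonneg_ofReal ν hq).lt_of_ne fun h => ?_
  have h1 := lpNormVec_ofReal_rpow ν hq
  rw [← h, Real.zero_rpow hq.ne'] at h1
  have : 0 < ∑ j, |ν j| ^ q := Finset.sum_pos
    (fun j _ => Real.rpow_pos_of_pos (abs_pos.2 (hν j).ne') _) Finset.univ_nonempty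
  linarith

theorem lpNormVec_top_pos [Nonempty (Fin N)] (hν : ∀ j, 0 < ν j) : 0 < lpNormVec ∞ ν := by
  obtain ⟨j, hj⟩ := exists_lpNormVec_top_eq ν
  exact hj ▸ abs_pos.2 (hν j).ne'

theorem lpNormVec_two_pos [Nonempty (Fin N)] (hν : ∀ j, 0 < ν j) : 0 < lpNormVec 2 ν :=
  (abs_pos.2 (hν (Classical.arbitrary _)).ne').trans_le (abs_le_lpNormVec_two ν _)

end LpNorms

/-! ### The threshold `γ_*` and the choice of the Chernoff parameter. -/

section GammaStar

variable {α : ℝ}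

theorem two_lt_conjExp (h1 : 1 < α) (h2 : α < 2) : 2 < conjExp α := by
  rw [conjExp, lt_div_iff₀ (by linarith)]; linarith

theorem conjExp_sub_one_mul (h1 : 1 < α) : (conjExp α - 1) * (α - 1) = 1 := by
  have : α - 1 ≠ 0 := by linarith
  rw [conjExp]; field_simp; ring

theorem half_le_conjExp_rpow (h1 : 1 < α) (h2 : α < 2) :
    1 / 2 ≤ (8 * conjExp α / 2 ^ conjExp α) ^ ((α - 1) / (2 - α)) := by
  have hq := two_lt_conjExp h1 h2
  -- Since `α_* - 2 = (2 - α) / (α - 1)`, the outer exponent turns this power of two into exactly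
  -- `2⁻¹`.
  have h3 : (2 : ℝ) ^ (2 - conjExp α) ≤ 8 * conjExp α / 2 ^ conjExp α := by
    rw [Real.rpow_sub two_pos]
    gcongr
    norm_num; linarith
  have h4 : (2 - conjExp α) * ((α - 1) / (2 - α)) = -1 := by
    have e := conjExp_sub_one_mul h1
    have : 2 - α ≠ 0 := by linarith
    field_simp
    linarith
  calc (1 / 2 : ℝ) = ((2 : ℝ) ^ (2 - conjExp α)) ^ ((α - 1) / (2 - α)) := by
        rw [← Real.rpow_mul two_pos.le, h4, Real.rpow_neg_one]; norm_num
    _ ≤ _ := Real.rpow_le_rpow (Real.rpow_nonneg two_pos.le _) h3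
        (div_nonneg (by linarith) (by linarith))

theorem tendsto_conjExp_rpow_one :
    Tendsto (fun α : ℝ => (8 * conjExp α / 2 ^ conjExp α) ^ ((α - 1) / (2 - α)))
      (𝓝[>] 1) (𝓝 (1 / 2)) := by
  -- For `1 < α < 2` this equals the given expression, by `α_* * (α - 1) = α`; it is continuous at
  -- `1` because `t * log t` is continuous at `0`.
  have hc : ContinuousAt (fun α : ℝ => (Real.exp ((α - 1) * Real.log (8 * α) -
      (α - 1) * Real.log (α - 1)) * 2 ^ (-α)) ^ (1 / (2 - α))) 1 := by
    have h1 : ContinuousAt (fun α : ℝ => (α - 1) * Real.log (α - 1)) 1 :=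
      (Real.continuous_mul_log.comp (continuous_id.sub continuous_const)).continuousAt
    have h2 : ContinuousAt (fun α : ℝ => Real.log (8 * α)) 1 :=
      ContinuousAt.log (by fun_prop) (by norm_num)
    have h3 : ContinuousAt (fun α : ℝ => (2 : ℝ) ^ (-α)) 1 :=
      ((Real.continuous_const_rpow two_ne_zero).comp continuous_neg).continuousAt
    refine ContinuousAt.rpow ?_ ?_ (Or.inl ?_)
    · exact (Real.continuous_exp.continuousAt.comp
        ((ContinuousAt.mul (by fun_prop) h2).sub h1)).mul h3
    · exact ContinuousAt.div (by fun_prop) (by fun_prop) (by norm_num)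
    · positivity
  have hv := hc.tendsto
  norm_num [Real.rpow_neg_one] at hv
  norm_num
  refine (hv.mono_left nhdsWithin_le_nhds).congr' ?_
  filter_upwards [Ioo_mem_nhdsGT (by norm_num : (1 : ℝ) < 2)] with α ⟨h1, h2⟩
  have h1' : 0 < α - 1 := by linarith
  have hq : 0 < conjExp α := by linarith [two_lt_conjExp h1 h2]
  have e1 : (α - 1) / (2 - α) = (α - 1) * (1 / (2 - α)) := by ring
  rw [e1, Real.rpow_mul (by positivity), one_div]
  congr 1
  have e2 : conjExp α * (α - 1) = α := by rw [conjExp]; field_simp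
  rw [Real.div_rpow (by positivity) (by positivity), ← Real.rpow_mul two_pos.le, e2,
    Real.rpow_neg two_pos.le, div_eq_mul_inv]
  congr 1
  rw [Real.rpow_def_of_pos (by positivity), conjExp, ← mul_div_assoc,
    Real.log_div (by positivity) h1'.ne']
  congr 1
  ring

theorem tendsto_conjExp_rpow_two :
    Tendsto (fun α : ℝ => (8 * conjExp α / 2 ^ conjExp α) ^ ((α - 1) / (2 - α)))
      (𝓝[<] 2) atTop := by
  have hbase : ContinuousAt (fun α : ℝ => 8 * conjExp α / 2 ^ conjExp α) 2 := by
    have h1 : ContinuousAt conjExp 2 :=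
      ContinuousAt.div (by fun_prop) (by fun_prop) (by norm_num)
    refine ContinuousAt.div (by fun_prop) ?_ (by positivity)
    exact (Real.continuous_const_rpow two_ne_zero).continuousAt.comp h1
  -- The base tends to `4`, so near `2` it exceeds `2`, while the exponent diverges.
  have hval : (2 : ℝ) < 8 * conjExp 2 / 2 ^ conjExp 2 := by
    norm_num [conjExp]
  have hev := (hbase.eventually (lt_mem_nhds hval)).filter_mono
    (nhdsWithin_le_nhds (s := Set.Iio 2))
  have hexp : Tendsto (fun α : ℝ => (α - 1) / (2 - α)) (𝓝[<] 2) atTop := by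
    have h1 : Tendsto (fun α : ℝ => α - 1) (𝓝[<] 2) (𝓝 1) := by
      have : ContinuousAt (fun α : ℝ => α - 1) 2 := by fun_prop
      have := this.tendsto.mono_left (nhdsWithin_le_nhds (s := Set.Iio (2 : ℝ)))
      norm_num at this
      exact this
    have h2 : Tendsto (fun α : ℝ => 2 - α) (𝓝[<] 2) (𝓝[>] 0) := by
      refine tendsto_nhdsWithin_iff.2 ⟨?_, ?_⟩
      · have : ContinuousAt (fun α : ℝ => 2 - α) 2 := by fun_prop
        have := this.tendsto.mono_left (nhdsWithin_le_nhds (s := Set.Iio (2 : ℝ)))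
        norm_num at this
        exact this
      · filter_upwards [self_mem_nhdsWithin] with α (h : α < 2)
        exact sub_pos.2 h
    exact h1.pos_mul_atTop one_pos (tendsto_inv_nhdsGT_zero.comp h2)
  refine tendsto_atTop_mono' _ ?_ hexp
  filter_upwards [hev, Ioo_mem_nhdsLT (by norm_num : (1 : ℝ) < 2)] with α hb ⟨h1, h2⟩
  have he : 0 ≤ (α - 1) / (2 - α) := div_nonneg (by linarith) (by linarith)
  refine le_trans ?_ (Real.rpow_le_rpow two_pos.le hb.le he)
  rw [Real.rpow_def_of_pos two_pos]
  have hx := Real.quadratic_le_exp_of_nonneg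
    (mul_nonneg (Real.log_nonneg one_le_two) he : 0 ≤ Real.log 2 * ((α - 1) / (2 - α)))
  have hl := Real.log_two_gt_d9
  have : (1 / 2 : ℝ) * ((α - 1) / (2 - α)) ≤ Real.log 2 * ((α - 1) / (2 - α)) := by
    gcongr; linarith
  nlinarith [sq_nonneg (Real.log 2 * ((α - 1) / (2 - α)) - 1)]

variable {N : ℕ} [Nonempty (Fin N)] {ν : Fin N → ℝ}

theorem one_le_normRatio (hν : ∀ j, 0 < ν j) (h1 : 1 < α) (h2 : α < 2) : 1 ≤ normRatio α ν := by
  have hq := two_lt_conjExp h1 h2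
  refine Real.one_le_rpow ?_ (div_nonneg (by linarith) (by linarith))
  rw [one_le_div (lpNormVec_ofReal_pos hν (by linarith))]
  exact lpNormVec_le_lpNormVec_two ν hq.le

theorem sixteen_mul_normRatio_le_gammaStarMid (hν : ∀ j, 0 < ν j) (h1 : 1 < α) (h2 : α < 2) :
    16 * normRatio α ν ≤ gammaStarMid α ν := by
  have h3 := half_le_conjExp_rpow h1 h2
  have h4 := one_le_normRatio hν h1 h2
  rw [gammaStarMid]
  nlinarith

theorem tendsto_gammaStarMid_one (hν : ∀ j, 0 < ν j) :
    Tendsto (fun α : ℝ => gammaStarMid α ν) (𝓝[>] 1)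
      (𝓝 (16 * (lpNormVec 2 ν / lpNormVec ∞ ν))) := by
  have hq : Tendsto conjExp (𝓝[>] 1) atTop := by
    have h1 : Tendsto (fun α : ℝ => α) (𝓝[>] 1) (𝓝 1) := nhdsWithin_le_nhds
    have h2 : Tendsto (fun α : ℝ => α - 1) (𝓝[>] 1) (𝓝[>] 0) := by
      refine tendsto_nhdsWithin_iff.2 ⟨?_, ?_⟩
      · simpa using h1.sub_const 1
      · filter_upwards [self_mem_nhdsWithin] with α (h : 1 < α)
        exact sub_pos.2 h
    exact h1.pos_mul_atTop one_pos (tendsto_inv_nhdsGT_zero.comp h2)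
  have hr : Tendsto (fun α : ℝ => normRatio α ν) (𝓝[>] 1)
      (𝓝 (lpNormVec 2 ν / lpNormVec ∞ ν)) := by
    have h1 := (tendsto_const_nhds (x := lpNormVec 2 ν)).div
      ((tendsto_lpNormVec_atTop ν).comp hq) (lpNormVec_top_pos hν).ne'
    have h2 : Tendsto (fun α : ℝ => α / (2 - α)) (𝓝[>] 1) (𝓝 1) := by
      have : ContinuousAt (fun α : ℝ => α / (2 - α)) 1 :=
        ContinuousAt.div (by fun_prop) (by fun_prop) (by norm_num)
      have := this.tendsto.mono_left (nhdsWithin_le_nhds (s := Set.Ioi (1 : ℝ)))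
      norm_num at this
      exact this
    simpa [normRatio] using h1.rpow h2 (Or.inr one_pos)
  have := (tendsto_conjExp_rpow_one.const_mul 32).mul hr
  norm_num at this
  exact this

theorem tendsto_gammaStarMid_two (hν : ∀ j, 0 < ν j) :
    Tendsto (fun α : ℝ => gammaStarMid α ν) (𝓝[<] 2) atTop := by
  refine tendsto_atTop_mono' _ ?_
    (tendsto_conjExp_rpow_two.const_mul_atTop (by norm_num : (0 : ℝ) < 32))
  filter_upwards [Ioo_mem_nhdsLT (by norm_num : (1 : ℝ) < 2)] with α ⟨h1, h2⟩
  have h3 := half_le_conjExp_rpow h1 h2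
  exact le_mul_of_one_le_right (by linarith) (one_le_normRatio hν h1 h2)

theorem gammaStarMid_rpow (hν : ∀ j, 0 < ν j) (h1 : 1 < α) (h2 : α < 2) :
    gammaStarMid α ν ^ (2 - α) = 128 * 8⁻¹ ^ α * conjExp α ^ (α - 1) *
      (lpNormVec 2 ν / lpNormVec (ENNReal.ofReal (conjExp α)) ν) ^ α := by
  have hq : 0 < conjExp α := by linarith [two_lt_conjExp h1 h2]
  have hR := div_pos (lpNormVec_two_pos hν) (lpNormVec_ofReal_pos hν hq)
  have hα : 2 - α ≠ 0 := by linarith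
  have hα1 : α - 1 ≠ 0 := by linarith
  have e2 : conjExp α * (α - 1) = α := by rw [conjExp]; field_simp
  rw [gammaStarMid, normRatio, Real.mul_rpow (by positivity) (by positivity),
    Real.mul_rpow (by positivity) (by positivity), ← Real.rpow_mul hR.le,
    ← Real.rpow_mul (by positivity), div_mul_cancel₀ _ hα, div_mul_cancel₀ _ hα,
    Real.div_rpow (by positivity) (by positivity), Real.mul_rpow (by positivity) hq.le,
    ← Real.rpow_mul two_pos.le, e2]
  congr 1
  have e3 : (32 : ℝ) ^ (2 - α) = 2 ^ (10 - 5 * α) := by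
    rw [show (32 : ℝ) = 2 ^ (5 : ℝ) by norm_num, ← Real.rpow_mul two_pos.le]; ring_nf
  have e4 : (8 : ℝ) ^ (α - 1) = 2 ^ (3 * α - 3) := by
    rw [show (8 : ℝ) = 2 ^ (3 : ℝ) by norm_num, ← Real.rpow_mul two_pos.le]; ring_nf
  have e5 : (128 : ℝ) * 8⁻¹ ^ α = 2 ^ (7 - 3 * α) := by
    rw [show (128 : ℝ) = 2 ^ (7 : ℝ) by norm_num, show (8⁻¹ : ℝ) = 2 ^ (-3 : ℝ) by
      rw [Real.rpow_neg two_pos.le]; norm_num, ← Real.rpow_mul two_pos.le,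
      ← Real.rpow_add two_pos]; ring_nf
  have e6 : (2 : ℝ) ^ (7 - 3 * α) = 2 ^ (10 - 5 * α) * 2 ^ (3 * α - 3) / 2 ^ α := by
    rw [← Real.rpow_add two_pos, ← Real.rpow_sub two_pos]; ring_nf
  rw [e3, e4, e5, e6]
  ring

/-- The right side is the Legendre value produced by `exists_chernoff_parameter`. Two Bernoulli
inequalities settle the constants: `α_* ^ (α - 1) ≤ 2` and `1 + α ≤ 2 ^ α`, the latter giving `4 * α
≤ 4 ^ α`. -/
theorem gammaStarMid_rpow_mul_le (hν : ∀ j, 0 < ν j) (h1 : 1 < α) (h2 : α < 2) {γ : ℝ}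
    (hγ : 0 ≤ γ) :
    1 / 64 * (gammaStarMid α ν ^ (2 - α) * γ ^ α) ≤
      (γ / 2 * (lpNormVec 2 ν / lpNormVec (ENNReal.ofReal (conjExp α)) ν)) ^ α / α := by
  have hq := two_lt_conjExp h1 h2
  have hR := div_pos (lpNormVec_two_pos hν) (lpNormVec_ofReal_pos hν (by linarith : 0 < conjExp α))
  rw [gammaStarMid_rpow hν h1 h2]
  set R := lpNormVec 2 ν / lpNormVec (ENNReal.ofReal (conjExp α)) ν
  have hqle : conjExp α ^ (α - 1) ≤ 2 := by
    have h := rpow_one_add_le_one_add_mul_self (s := conjExp α - 1) (by linarith)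
      (by linarith : 0 ≤ α - 1) (by linarith)
    rw [add_sub_cancel] at h
    linarith [conjExp_sub_one_mul h1]
  have h3 : 1 + α ≤ 2 ^ α := by
    have h := one_add_mul_self_le_rpow_one_add (s := 1) (by norm_num) h1.le
    norm_num at h
    exact h
  have h4 : 4 * α ≤ 2 ^ α * 2 ^ α := by nlinarith [sq_nonneg (α - 1)]
  have e8 : (8 : ℝ) ^ α = 2 ^ α * 2 ^ α * 2 ^ α := by
    rw [← Real.mul_rpow two_pos.le two_pos.le, ← Real.mul_rpow (by norm_num) two_pos.le]; norm_num
  have hα0 : 0 < α := by linarith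
  have hA : (0 : ℝ) < 2 ^ α := by positivity
  have key : 2 * conjExp α ^ (α - 1) / 8 ^ α ≤ 1 / (2 ^ α * α) := by
    rw [div_le_div_iff₀ (by positivity) (by positivity), e8, one_mul]
    calc 2 * conjExp α ^ (α - 1) * (2 ^ α * α) ≤ 2 * 2 * (2 ^ α * α) := by gcongr
      _ = 4 * α * 2 ^ α := by ring
      _ ≤ 2 ^ α * 2 ^ α * 2 ^ α := by gcongr
  rw [Real.mul_rpow (by positivity) hR.le, Real.div_rpow hγ two_pos.le,
    Real.inv_rpow (by norm_num)]
  calc 1 / 64 * (128 * (8 ^ α)⁻¹ * conjExp α ^ (α - 1) * R ^ α * γ ^ α)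
      = (2 * conjExp α ^ (α - 1) / 8 ^ α) * (γ ^ α * R ^ α) := by ring
    _ ≤ 1 / (2 ^ α * α) * (γ ^ α * R ^ α) := mul_le_mul_of_nonneg_right key (by positivity)
    _ = _ := by field_simp

theorem tailExponent_le_sq {N : ℕ} {ν : Fin N → ℝ} {α γ : ℝ} (hγ : 0 ≤ γ) :
    tailExponent α ν γ ≤ γ ^ 2 := by
  have h : (ENNReal.ofReal γ ^ (2 : ℝ)).toReal = γ ^ 2 := by
    rw [← ENNReal.toReal_rpow, ENNReal.toReal_ofReal hγ, Real.rpow_two]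
  rw [← h]
  exact ENNReal.toReal_mono (ENNReal.rpow_ne_top_of_nonneg two_pos.le ENNReal.ofReal_ne_top)
    (min_le_left _ _)

theorem tailExponent_le_of_gammaStar_eq {N : ℕ} {ν : Fin N → ℝ} {α γ g : ℝ} (hα : 0 ≤ α)
    (hα2 : α ≤ 2) (hγ : 0 ≤ γ) (hg : 0 ≤ g) (h : gammaStar α ν = ENNReal.ofReal g) :
    tailExponent α ν γ ≤ g ^ (2 - α) * γ ^ α := by
  have h1 : (gammaStar α ν ^ (2 - α) * ENNReal.ofReal γ ^ α).toReal = g ^ (2 - α) * γ ^ α := by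
    rw [h, ENNReal.toReal_mul, ← ENNReal.toReal_rpow, ← ENNReal.toReal_rpow,
      ENNReal.toReal_ofReal hγ, ENNReal.toReal_ofReal hg]
  rw [← h1]
  refine ENNReal.toReal_mono (ENNReal.mul_ne_top ?_ ?_) (min_le_right _ _)
  · rw [h]
    exact ENNReal.rpow_ne_top_of_nonneg (by linarith) ENNReal.ofReal_ne_top
  · exact ENNReal.rpow_ne_top_of_nonneg hα ENNReal.ofReal_ne_top

/-- Near-optimal choice of the parameter in the exponential Chebyshev inequality. -/
theorem exists_chernoff_parameter {α γ R : ℝ} (h1 : 1 < α) (h2 : α < 2) (hγ : 0 ≤ γ) (hR : 0 < R) :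
    ∃ τ : ℝ, 0 ≤ τ ∧
      (-(γ * τ) + 6 * τ ^ 2 + (τ / R) ^ conjExp α / conjExp α ≤ -(γ ^ 2 / 48) ∨
      -(γ * τ) + 6 * τ ^ 2 + (τ / R) ^ conjExp α / conjExp α ≤ -((γ / 2 * R) ^ α / α)) := by
  have hq := two_lt_conjExp h1 h2
  have hqα := conjExp_sub_one_mul h1
  have hg : 0 ≤ γ / 2 * R := by positivity
  set q := conjExp α
  have e2 : (α - 1) * q = α := by linarith
  have hP : 0 ≤ (γ / 2 * R) ^ (α - 1) := Real.rpow_nonneg hg _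
  have hαP : (γ / 2 * R) ^ α = (γ / 2 * R) ^ (α - 1) * (γ / 2 * R) := by
    rw [← Real.rpow_add_one' hg (by linarith)]; ring_nf
  -- Half of `γ * τ` pays for `6 * τ ^ 2` when `τ ≤ γ / 12`; the tested point minimizes the other
  -- half plus the `α_*` term. If it exceeds `γ / 12`, then `τ = γ / 12` serves.
  rcases le_or_gt ((γ / 2 * R) ^ (α - 1) * R) (γ / 12) with h | h
  · refine ⟨(γ / 2 * R) ^ (α - 1) * R, mul_nonneg hP hR.le, Or.inr ?_⟩
    rw [mul_div_cancel_right₀ _ hR.ne', ← Real.rpow_mul hg, e2]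
    have e3 : (γ / 2 * R) ^ α / q = (γ / 2 * R) ^ α - (γ / 2 * R) ^ α / α := by
      have e : 1 / q = 1 - 1 / α := by
        have : q ≠ 0 := by linarith
        have : α ≠ 0 := by linarith
        field_simp; linarith
      rw [div_eq_mul_one_div, e]; ring
    rw [e3, hαP]
    have h0 := mul_nonneg hP hR.le
    nlinarith
  · refine ⟨γ / 12, by positivity, Or.inl ?_⟩
    have h3 : (γ / 12 / R) ^ q ≤ γ / 12 * (γ / 2) := by
      have h0 : 0 ≤ γ / 12 / R := by positivity
      have h4 : γ / 12 / R ≤ (γ / 2 * R) ^ (α - 1) := by rw [div_le_iff₀ hR]; exact h.le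
      have h5 : (γ / 12 / R) ^ q = γ / 12 / R * (γ / 12 / R) ^ (q - 1) := by
        rw [mul_comm, ← Real.rpow_add_one' h0 (by linarith)]; ring_nf
      have h6 := Real.rpow_le_rpow h0 h4 (by linarith : 0 ≤ q - 1)
      rw [← Real.rpow_mul hg, mul_comm (α - 1), hqα, Real.rpow_one] at h6
      rw [h5]
      refine (mul_le_mul_of_nonneg_left h6 h0).trans (le_of_eq ?_)
      field_simp
    have h4 : (γ / 12 / R) ^ q / q ≤ γ / 12 * (γ / 2) / 2 := by
      refine div_le_div₀ (by positivity) h3 two_pos hq.le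
    nlinarith

end GammaStar

/-! ### Tail bounds for the martingale under each assumption. -/

section TailBounds

variable {E : Type*} [NormedAddCommGroup E] [NormedSpace ℝ E] [FiniteDimensional ℝ E]
  {Ω : Type*} [mΩ : MeasurableSpace Ω] {μ : Measure Ω} [IsProbabilityMeasure μ]
  {ℱ : Filtration ℕ mΩ} {κ : ℝ} {ξ : ℕ → Ω → E} {σ : ℕ → ℝ} {N : ℕ} {γ : ℝ}

theorem sum_Icc_one_eq_sum_range (f : ℕ → ℝ) (N : ℕ) :
    ∑ i ∈ Finset.Icc 1 N, f i = ∑ i ∈ Finset.range N, f (i + 1) := by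
  rw [Finset.range_eq_Ico, Finset.sum_Ico_add' f 0 N 1, zero_add]
  rfl

theorem sum_initialVec (f : ℝ → ℝ) (σ : ℕ → ℝ) (N : ℕ) :
    ∑ j, f (initialVec σ N j) = ∑ i ∈ Finset.range N, f (σ (i + 1)) :=
  Fin.sum_univ_eq_sum_range (fun i => f (σ (i + 1))) N

theorem lpNormVec_two_initialVec (σ : ℕ → ℝ) (N : ℕ) :
    lpNormVec 2 (initialVec σ N) = √(∑ i ∈ Finset.Icc 1 N, σ i ^ 2) := by
  rw [lpNormVec_two, sum_initialVec (fun x => x ^ 2), sum_Icc_one_eq_sum_range (fun i => σ i ^ 2)]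

theorem sqrt_sum_sq_pos (hσ : ∀ i, 1 ≤ i → 0 < σ i) (hN : 1 ≤ N) :
    0 < √(∑ i ∈ Finset.Icc 1 N, σ i ^ 2) :=
  Real.sqrt_pos.2 (Finset.sum_pos (fun i hi => pow_pos (hσ i (Finset.mem_Icc.1 hi).1) 2)
    ⟨1, Finset.mem_Icc.2 ⟨le_rfl, hN⟩⟩)

theorem sum_range_mul_sq (σ : ℕ → ℝ) (N : ℕ) (A l : ℝ) :
    ∑ i ∈ Finset.range N, A * (l * σ (i + 1)) ^ 2 =
      A * (l * √(∑ i ∈ Finset.Icc 1 N, σ i ^ 2)) ^ 2 := by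
  rw [mul_pow, Real.sq_sqrt (Finset.sum_nonneg fun i _ => sq_nonneg _),
    sum_Icc_one_eq_sum_range (fun i => σ i ^ 2), Finset.mul_sum, Finset.mul_sum]
  simp only [mul_pow]

/-- The tail bound obtained from the optimal smoothing parameter. -/
theorem measure_norm_partialSum_ge_le_of_stepBound (hE : IsRegularSpace E κ)
    (hξ : IsMartingaleDifference μ ℱ ξ) (hσ : ∀ i, 1 ≤ i → 0 < σ i) (hN : 1 ≤ N) {ρ : ℝ}
    (hρ : 0 < ρ) {τ : ℝ} (hτ : 0 ≤ τ) {l : ℝ} (hl : l * √(∑ i ∈ Finset.Icc 1 N, σ i ^ 2) = τ)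
    {f : ℕ → ℝ} (hstep : ∀ C, 0 ≤ C → ∀ i < N,
      StepBound μ (ℱ i) (ξ (i + 1)) l C (l * C * (ρ * σ (i + 1) ^ 2) + f i)) :
    μ.real {ω | (√(2 * ρ * κ) + √2 * γ) * √(∑ i ∈ Finset.Icc 1 N, σ i ^ 2) ≤ ‖partialSum ξ N ω‖} ≤
      Real.exp (-(√2 * γ * τ) + ∑ i ∈ Finset.range N, f i) := by
  have hs := sqrt_sum_sq_pos hσ hN
  have hs2 : √(∑ i ∈ Finset.Icc 1 N, σ i ^ 2) ^ 2 = ∑ i ∈ Finset.range N, σ (i + 1) ^ 2 := by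
    rw [Real.sq_sqrt (Finset.sum_nonneg fun i _ => sq_nonneg _),
      sum_Icc_one_eq_sum_range (fun i => σ i ^ 2)]
  set s := √(∑ i ∈ Finset.Icc 1 N, σ i ^ 2)
  have hκ := hE.one_le
  have hk : 0 < √(ρ * κ) := Real.sqrt_pos.2 (by positivity)
  have hl0 : 0 ≤ l := by
    by_contra! h
    nlinarith
  -- This `β` balances `l * β / 2` against the curvature cost `l * κ * ρ * s ^ 2 / (2 * β)`; their
  -- sum `l * s * √(ρ * κ)` is covered by the shift in the threshold.
  have hβ : 0 < √(ρ * κ) * s := by positivity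
  have hC : 0 ≤ κ / (2 * (√(ρ * κ) * s)) := by positivity
  refine (measure_norm_partialSum_ge_le hE hξ hβ hl0 (hstep _ hC) _).trans (Real.exp_le_exp.2 ?_)
  rw [Finset.sum_add_distrib, ← Finset.mul_sum, ← Finset.mul_sum, ← hs2]
  have h1 : √(ρ * κ) ≤ √(2 * ρ * κ) :=
    Real.sqrt_le_sqrt (by nlinarith [mul_pos hρ (by linarith : 0 < κ)])
  have h2 : l * (κ / (2 * (√(ρ * κ) * s))) * (ρ * s ^ 2) = l * s * √(ρ * κ) / 2 := by
    have e : √(ρ * κ) ^ 2 = ρ * κ := Real.sq_sqrt (by positivity)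
    have e' : ρ * κ / √(ρ * κ) = √(ρ * κ) := by rw [div_eq_iff hk.ne', ← sq, e]
    calc l * (κ / (2 * (√(ρ * κ) * s))) * (ρ * s ^ 2) = l * s * (ρ * κ / √(ρ * κ)) / 2 := by
          field_simp
      _ = l * s * √(ρ * κ) / 2 := by rw [e']
  rw [h2]
  have h3 : l * s * √(ρ * κ) ≤ l * s * √(2 * ρ * κ) :=
    mul_le_mul_of_nonneg_left h1 (by positivity)
  rw [← hl]
  linarith

theorem measure_norm_partialSum_ge_le_of_norm_le (hE : IsRegularSpace E κ)
    (hξ : IsMartingaleDifference μ ℱ ξ) (hσ : ∀ i, 1 ≤ i → 0 < σ i) (hN : 1 ≤ N) (hγ : 0 ≤ γ)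
    (hb : ∀ i, 1 ≤ i → ∀ᵐ ω ∂μ, ‖ξ i ω‖ ≤ σ i) :
    μ.real {ω | (√(2 * κ) + √2 * γ) * √(∑ i ∈ Finset.Icc 1 N, σ i ^ 2) ≤ ‖partialSum ξ N ω‖} ≤
      Real.exp (-γ ^ 2 / 2) := by
  have hs := sqrt_sum_sq_pos hσ hN
  -- `τ = γ / √2` minimizes `-(√2 * γ * τ) + τ ^ 2`.
  have hl := div_mul_cancel₀ (γ * √2 / 2) hs.ne'
  have h := measure_norm_partialSum_ge_le_of_stepBound (γ := γ) hE hξ hσ hN one_pos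
    (by positivity) hl (f := fun i => 1 * (γ * √2 / 2 / _ * σ (i + 1)) ^ 2) fun C hC i _ => by
      rw [one_mul, one_mul]
      exact stepBound_of_norm_le (ℱ.le i) (by positivity) hC (hb (i + 1) (by omega))
  rw [mul_one, sum_range_mul_sq, hl] at h
  refine h.trans (Real.exp_le_exp.2 ?_)
  nlinarith [Real.sq_sqrt two_pos.le]

theorem measure_norm_partialSum_ge_le_of_lightTail_two (hE : IsRegularSpace E κ)
    (hξ : IsMartingaleDifference μ ℱ ξ) (hσ : ∀ i, 1 ≤ i → 0 < σ i) (hN : 1 ≤ N) (hγ : 0 ≤ γ)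
    (ht : LightTail μ ℱ 2 σ ξ) :
    μ.real {ω | (√(2 * κ) + √2 * γ) * √(∑ i ∈ Finset.Icc 1 N, σ i ^ 2) ≤ ‖partialSum ξ N ω‖} ≤
      Real.exp (-γ ^ 2 / 3) := by
  have hs := sqrt_sum_sq_pos hσ hN
  -- With `τ = γ / √2` the exponent is `-γ ^ 2 + 5 / 8 * γ ^ 2`, below `-γ ^ 2 / 3`.
  have hl := div_mul_cancel₀ (γ * √2 / 2) hs.ne'
  have h := measure_norm_partialSum_ge_le_of_stepBound (γ := γ) hE hξ hσ hN one_pos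
    (by positivity) hl (f := fun i => 5 / 4 * (γ * √2 / 2 / _ * σ (i + 1)) ^ 2) fun C hC i _ => by
      rw [one_mul]
      exact stepBound_of_condExp_exp_sq_le (ℱ.le i) (by positivity) hC (hσ (i + 1) (by omega))
        (ht i).1 (ht i).2
  rw [mul_one, sum_range_mul_sq, hl] at h
  refine h.trans (Real.exp_le_exp.2 ?_)
  nlinarith [Real.sq_sqrt two_pos.le]

theorem measure_norm_partialSum_ge_le_of_lightTail_one (hE : IsRegularSpace E κ)
    (hξ : IsMartingaleDifference μ ℱ ξ) (hσ : ∀ i, 1 ≤ i → 0 < σ i) (hN : 1 ≤ N) (hγ : 0 ≤ γ)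
    (ht : LightTail μ ℱ 1 σ ξ) :
    μ.real {ω | (√(2 * Real.exp 1 * κ) + √2 * γ) * √(∑ i ∈ Finset.Icc 1 N, σ i ^ 2)
        ≤ ‖partialSum ξ N ω‖} ≤
      Real.exp (-(1 / 64) * tailExponent 1 (initialVec σ N) γ) := by
  have : Nonempty (Fin N) := Fin.pos_iff_nonempty.1 hN
  have hs := sqrt_sum_sq_pos hσ hN
  have hM := lpNormVec_top_pos (ν := initialVec σ N) fun j => hσ (j + 1) (by omega)
  have h2 := lpNormVec_two_initialVec σ N
  have hT := tailExponent_le_of_gammaStar_eq (ν := initialVec σ N)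
    (g := 16 * (lpNormVec 2 (initialVec σ N) / lpNormVec ∞ (initialVec σ N)))
    zero_le_one one_le_two hγ (by rw [h2]; positivity)
    (by simp [gammaStar])
  have hsq := tailExponent_le_sq (α := 1) (ν := initialVec σ N) hγ
  norm_num at hT
  rw [h2] at hT
  set M := lpNormVec ∞ (initialVec σ N)
  set s := √(∑ i ∈ Finset.Icc 1 N, σ i ^ 2) with hsdef
  -- The second entry enforces `l * σ_i ≤ 1 / 2` for all `i`; the first keeps `6 * τ ^ 2 ≤ γ * τ /
  -- 2`.
  set τ := min (γ / 12) (s / M / 2) with hτdef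
  have hτ : 0 ≤ τ := le_min (by positivity) (by positivity)
  have hl : τ / s * s = τ := div_mul_cancel₀ τ hs.ne'
  have h := measure_norm_partialSum_ge_le_of_stepBound (γ := γ) hE hξ hσ hN (Real.exp_pos 1)
    hτ hl (f := fun i => 6 * (τ / s * σ (i + 1)) ^ 2) fun C hC i hi => by
      refine stepBound_of_condExp_exp_rpow_le_of_le (ℱ.le i) (by positivity) hC
        (hσ (i + 1) (by omega)) le_rfl ?_ (ht i).1 (ht i).2
      have h3 : σ (i + 1) ≤ M := (le_abs_self _).trans
        (abs_le_lpNormVec_top (initialVec σ N) ⟨i, hi⟩)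
      calc τ / s * σ (i + 1) ≤ (s / M / 2) / s * M := by
            gcongr
            · exact (hσ (i + 1) (by omega)).le
            · exact min_le_right _ _
        _ = 1 / 2 := by field_simp
  rw [sum_range_mul_sq, ← hsdef, hl] at h
  refine h.trans (Real.exp_le_exp.2 ?_)
  have h1 : 1 ≤ √2 := Real.one_le_sqrt.2 one_le_two
  have h3 : γ * τ ≤ √2 * γ * τ := by nlinarith [mul_nonneg hγ hτ]
  have h4 : τ ≤ γ / 12 := min_le_left _ _
  have h5 : -(γ * τ) + 6 * τ ^ 2 ≤ -(γ / 2 * τ) := by nlinarith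
  rcases min_choice (γ / 12) (s / M / 2) with hc | hc
  · rw [← hτdef] at hc
    rw [hc] at h3 h5 ⊢
    nlinarith
  · rw [← hτdef] at hc
    have h6 : γ / 2 * τ = s / M * γ / 4 := by rw [hc]; ring
    linarith

theorem measure_norm_partialSum_ge_le_of_lightTail (hE : IsRegularSpace E κ)
    (hξ : IsMartingaleDifference μ ℱ ξ) (hσ : ∀ i, 1 ≤ i → 0 < σ i) (hN : 1 ≤ N) (hγ : 0 ≤ γ)
    {α : ℝ} (hα1 : 1 < α) (hα2 : α < 2) (ht : LightTail μ ℱ α σ ξ) :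
    μ.real {ω | (√(2 * Real.exp 1 * κ) + √2 * γ) * √(∑ i ∈ Finset.Icc 1 N, σ i ^ 2)
        ≤ ‖partialSum ξ N ω‖} ≤
      Real.exp (-(1 / 64) * tailExponent α (initialVec σ N) γ) := by
  have : Nonempty (Fin N) := Fin.pos_iff_nonempty.1 hN
  have hν : ∀ j, 0 < initialVec σ N j := fun j => hσ (j + 1) (by omega)
  have hs := sqrt_sum_sq_pos hσ hN
  have hq : 0 < conjExp α := by linarith [two_lt_conjExp hα1 hα2]
  have hQ := lpNormVec_ofReal_pos hν hq
  have hg0 : 0 ≤ gammaStarMid α (initialVec σ N) := by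
    linarith [sixteen_mul_normRatio_le_gammaStarMid hν hα1 hα2, one_le_normRatio hν hα1 hα2]
  have hT := tailExponent_le_of_gammaStar_eq (by linarith) hα2.le hγ hg0
    (by rw [gammaStar, if_neg hα1.ne', if_neg hα2.ne])
  have hT' := gammaStarMid_rpow_mul_le hν hα1 hα2 hγ
  have hsq := tailExponent_le_sq (α := α) (ν := initialVec σ N) hγ
  have hsum := lpNormVec_ofReal_rpow (initialVec σ N) hq
  rw [lpNormVec_two_initialVec] at hT'
  set Q := lpNormVec (ENNReal.ofReal (conjExp α)) (initialVec σ N)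
  set s := √(∑ i ∈ Finset.Icc 1 N, σ i ^ 2) with hsdef
  obtain ⟨τ, hτ, hopt⟩ := exists_chernoff_parameter hα1 hα2 hγ (div_pos hs hQ)
  have hl : τ / s * s = τ := div_mul_cancel₀ τ hs.ne'
  have h := measure_norm_partialSum_ge_le_of_stepBound (γ := γ) hE hξ hσ hN (Real.exp_pos 1)
    hτ hl (f := fun i => 6 * (τ / s * σ (i + 1)) ^ 2 +
      (τ / s * σ (i + 1)) ^ conjExp α / conjExp α) fun C hC i _ =>
      stepBound_of_condExp_exp_rpow_le (ℱ.le i) (by positivity) hC (hσ (i + 1) (by omega)) hα1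
        (ht i).1 (ht i).2
  have hsum' : ∑ i ∈ Finset.range N, (τ / s * σ (i + 1)) ^ conjExp α / conjExp α =
      (τ / (s / Q)) ^ conjExp α / conjExp α := by
    have e : τ / (s / Q) = τ / s * Q := by field_simp
    rw [e, Real.mul_rpow (by positivity) hQ.le, hsum, sum_initialVec (fun x => |x| ^ conjExp α),
      Finset.mul_sum, Finset.sum_div]
    refine Finset.sum_congr rfl fun i _ => ?_
    have hi := hσ (i + 1) (by omega)
    rw [Real.mul_rpow (by positivity) hi.le, abs_of_pos hi]
  rw [Finset.sum_add_distrib, sum_range_mul_sq, hsum', ← hsdef, hl] at h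
  refine h.trans (Real.exp_le_exp.2 ?_)
  have h1 : 1 ≤ √2 := Real.one_le_sqrt.2 one_le_two
  have h3 : γ * τ ≤ √2 * γ * τ := by nlinarith [mul_nonneg hγ hτ]
  rcases hopt with hc | hc
  · nlinarith [sq_nonneg γ]
  · linarith

end TailBounds

end RegularSpace

theorem theorem1
    {E : Type*} [NormedAddCommGroup E] [NormedSpace ℝ E] [FiniteDimensional ℝ E]
    {Ω : Type*} [TopologicalSpace Ω] [PolishSpace Ω] [mΩ : MeasurableSpace Ω] [BorelSpace Ω]
    (μ : Measure Ω) [IsProbabilityMeasure μ]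
    (ℱ : Filtration ℕ mΩ) (hℱ : ℱ 0 = ⊥)
    (κ : ℝ) (hE : RegularSpace.IsRegularSpace E κ)
    (ξ : ℕ → Ω → E) (hξ : RegularSpace.IsMartingaleDifference μ ℱ ξ)
    (σ : ℕ → ℝ) (hσ : ∀ i, 1 ≤ i → 0 < σ i) :
    -- the general bound
    (∀ α : ℝ, 1 ≤ α → α ≤ 2 → RegularSpace.LightTail μ ℱ α σ ξ →
      ∀ N : ℕ, 1 ≤ N → ∀ γ : ℝ, 0 ≤ γ →
        μ.real {ω | (√(2 * Real.exp 1 * κ) + √2 * γ) * √(∑ i ∈ Finset.Icc 1 N, σ i ^ 2)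
            ≤ ‖RegularSpace.partialSum ξ N ω‖}
          ≤ 2 * Real.exp (-(1 / 64) *
              RegularSpace.tailExponent α (RegularSpace.initialVec σ N) γ)) ∧
    -- the properties of `γ_*`: lower bounds and limits at the end points
    (∀ N : ℕ, 1 ≤ N →
      (∀ α : ℝ, 1 < α → α < 2 →
        16 * RegularSpace.normRatio α (RegularSpace.initialVec σ N)
            ≤ RegularSpace.gammaStarMid α (RegularSpace.initialVec σ N) ∧
        16 ≤ 16 * RegularSpace.normRatio α (RegularSpace.initialVec σ N)) ∧
      Tendsto (fun α : ℝ => RegularSpace.gammaStarMid α (RegularSpace.initialVec σ N))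
        (𝓝[>] 1)
        (𝓝 (16 * (RegularSpace.lpNormVec 2 (RegularSpace.initialVec σ N) /
          RegularSpace.lpNormVec ∞ (RegularSpace.initialVec σ N)))) ∧
      Tendsto (fun α : ℝ => RegularSpace.gammaStarMid α (RegularSpace.initialVec σ N))
        (𝓝[<] 2) atTop) ∧
    -- the improved bound for `α = 2`
    (RegularSpace.LightTail μ ℱ 2 σ ξ →
      ∀ N : ℕ, 1 ≤ N → ∀ γ : ℝ, 0 ≤ γ →
        μ.real {ω | (√(2 * κ) + √2 * γ) * √(∑ i ∈ Finset.Icc 1 N, σ i ^ 2)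
            ≤ ‖RegularSpace.partialSum ξ N ω‖}
          ≤ Real.exp (-γ ^ 2 / 3)) ∧
    -- the improved bound for almost surely bounded increments
    ((∀ i, 1 ≤ i → ∀ᵐ ω ∂μ, ‖ξ i ω‖ ≤ σ i) →
      ∀ N : ℕ, 1 ≤ N → ∀ γ : ℝ, 0 ≤ γ →
        μ.real {ω | (√(2 * κ) + √2 * γ) * √(∑ i ∈ Finset.Icc 1 N, σ i ^ 2)
            ≤ ‖RegularSpace.partialSum ξ N ω‖}
          ≤ Real.exp (-γ ^ 2 / 2)) := by
  refine ⟨fun α hα1 hα2 ht N hN γ hγ => ?_, fun N hN => ?_,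
    fun ht N hN γ hγ => RegularSpace.measure_norm_partialSum_ge_le_of_lightTail_two hE hξ hσ hN hγ ht,
    fun hb N hN γ hγ => RegularSpace.measure_norm_partialSum_ge_le_of_norm_le hE hξ hσ hN hγ hb⟩
  -- Each case is proved without the factor `2`.
  · have htwo : ∀ x : ℝ, Real.exp x ≤ 2 * Real.exp x := fun x => by linarith [Real.exp_pos x]
    rcases hα1.eq_or_lt with rfl | hα1
    · exact (RegularSpace.measure_norm_partialSum_ge_le_of_lightTail_one hE hξ hσ hN hγ ht).trans
        (htwo _)
    rcases hα2.lt_or_eq with hα2 | rfl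
    · exact (RegularSpace.measure_norm_partialSum_ge_le_of_lightTail hE hξ hσ hN hγ hα1 hα2
        ht).trans (htwo _)
    -- For `α = 2` the sharper bound suffices: its threshold is lower and `1 / 3 ≥ 1 / 64`.
    · refine le_trans ?_ ((RegularSpace.measure_norm_partialSum_ge_le_of_lightTail_two hE hξ hσ hN
        hγ ht).trans ((Real.exp_le_exp.2 ?_).trans (htwo _)))
      · refine measureReal_mono (fun ω h => le_trans ?_ (Set.mem_ofPred_eq ▸ h)) (measure_ne_top μ _)
        have hκ := hE.one_le
        have h1 : √(2 * κ) ≤ √(2 * Real.exp 1 * κ) :=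
          Real.sqrt_le_sqrt (by nlinarith [Real.exp_one_gt_two])
        gcongr
      · have := RegularSpace.tailExponent_le_sq (α := 2) (ν := RegularSpace.initialVec σ N) hγ
        nlinarith [sq_nonneg γ]
  · have : Nonempty (Fin N) := Fin.pos_iff_nonempty.1 hN
    have hν : ∀ j, 0 < RegularSpace.initialVec σ N j := fun j => hσ (j + 1) (by omega)
    refine ⟨fun α h1 h2 =>
      ⟨RegularSpace.sixteen_mul_normRatio_le_gammaStarMid hν h1 h2, ?_⟩,
      RegularSpace.tendsto_gammaStarMid_one hν, RegularSpace.tendsto_gammaStarMid_two hν⟩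
    linarith [RegularSpace.one_le_normRatio hν h1 h2]
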